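/- Let $q\ge 3$ be a prime power. For $v\ge 3$ let $A_q(v,4;3)$ be the maximum size of a set of $3$-dimensional subspaces of $\mathbb{F}_q^v$ such that any two distinct members $U,W$ have subspace distance $\dim(U+W)-\dim(U\cap W)\ge 4$, and for integers $0\le k\le n$ let $\binom{n}{k}_q=\prod_{i=1}^{k}\frac{q^{n-k+i}-1}{q^i-1}$ be the Gaussian binomial coefficient (with $\binom{n}{k}_q=0$ for $k>n\ge 0$). Then the limit below exists and \[ \lim_{v\to\infty}\frac{A_q(v,4;3)}{q^{2v-6}+\binom{v-3}{2}_q}\ \ge\ 1+\frac{1}{2q^3}. \] Consequently, there is a $v_0$ (depending on $q$) such that for every $v\ge v_0$ there is a set of $3$-dimensional subspaces of $\mathbb{F}_q^v$ with pairwise subspace distance at least $4$ whose size exceeds $q^{2v-6}+\binom{v-3}{2}_q$, the MRD bound for codes containing a lifted MRD code. Moreover, $A_q(v,4;3)\ge q^{2v-10}(q^4+q+1)$ for all $v\ge 12$. -/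

import Mathlib

/-- The subspace distance `dim (U + W) - dim (U ∩ W)`; the natural-number subtraction never
truncates, since `U ∩ W` is contained in `U + W`. -/
noncomputable def subspaceDist {F V : Type*} [Field F] [AddCommGroup V] [Module F V]
    (U W : Submodule F V) : ℕ :=
  Module.finrank F ↥(U ⊔ W) - Module.finrank F ↥(U ⊓ W)

/-- `C` is a constant dimension code in `F ^ v`: all its codewords are `k`-dimensional subspaces
and any two distinct codewords have subspace distance at least `d`. -/
def IsConstDimCode (F : Type*) [Field F] (v d k : ℕ)
    (C : Finset (Submodule F (Fin v → F))) : Prop :=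
  (∀ U ∈ C, Module.finrank F U = k) ∧
    ∀ U ∈ C, ∀ W ∈ C, U ≠ W → d ≤ subspaceDist U W

/-- The maximum size `A_q(v, d; k)` of a constant dimension code in `F ^ v`, where `F` is the
field with `q` elements. It is attained, see `exists_isConstDimCode_card_eq`. -/
noncomputable def maxCodeSize (F : Type*) [Field F] (v d k : ℕ) : ℕ :=
  sSup {n : ℕ | ∃ C : Finset (Submodule F (Fin v → F)), IsConstDimCode F v d k C ∧ C.card = n}

theorem bddAbove_constDimCode_card (F : Type*) [Field F] [Finite F] (v d k : ℕ) :
    BddAbove {n : ℕ | ∃ C : Finset (Submodule F (Fin v → F)),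
      IsConstDimCode F v d k C ∧ C.card = n} := by
  classical
  have : Finite (Submodule F (Fin v → F)) := inferInstance
  have := Fintype.ofFinite (Submodule F (Fin v → F))
  refine ⟨Fintype.card (Submodule F (Fin v → F)), ?_⟩
  rintro n ⟨C, -, rfl⟩
  exact Finset.card_le_univ C

theorem exists_isConstDimCode_card_eq (F : Type*) [Field F] [Finite F] (v d k : ℕ) :
    ∃ C : Finset (Submodule F (Fin v → F)),
      IsConstDimCode F v d k C ∧ C.card = maxCodeSize F v d k :=
  Nat.sSup_mem (s := {n : ℕ | ∃ C : Finset (Submodule F (Fin v → F)),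
    IsConstDimCode F v d k C ∧ C.card = n}) ⟨0, ∅, by simp [IsConstDimCode]⟩
    (bddAbove_constDimCode_card F v d k)

/-- The Gaussian binomial coefficient `[n choose k]_q` for an integer `q ≥ 2`. -/
noncomputable def gaussBinom (q n k : ℕ) : ℝ :=
  if k ≤ n then ∏ i ∈ Finset.Icc 1 k, ((q : ℝ) ^ (n - k + i) - 1) / ((q : ℝ) ^ i - 1) else 0

/-!
A plane code of subspace distance at least four is a set of planes any two of which share at most
a point. All three claims follow from one code in dimension seven with at least
`q ^ 8 + q ^ 5 + q ^ 4` planes (`le_maxCodeSize_seven`) together with the linkage inequality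
`A (m + j) ≥ q ^ (2 j) A (m)` for `j ≥ 3` (`maxCodeSize_mul_le`).

*Linkage.* If `K` has degree `j` over `F`, a nonzero map `x ↦ a x + b x ^ q` has a kernel of
dimension at most one. Replacing every plane `U` of a code in `F ^ m` by the `q ^ (2 j)` graphs of
such maps, composed with an embedding of `U` into `K`, gives a code in `F ^ m × K`. Hence
`A (v) / q ^ (2 v)`, which is at most one, converges to its supremum, and the value at seven bounds
the limit from below.

*Dimension seven.* Let `K` have degree four over `F`, let `W` be its hyperplane of trace zero, and
put `[u, x] = u x ^ q - u ^ q x`. The ambient space is `W × K`. The `q ^ 8` graphs of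
`x ↦ a x + b x ^ q` form a code all of whose planes avoid the special subspace `0 × K`. Those of the
form `x ↦ c [u, x]` with `c ≠ 0` and `Tr u = 1` are removed; there are at most
`q ^ 3 (q ^ 4 - 1)` of them. The lines which become free are used by planes meeting `0 × K` in a
point: for `g` outside `F` let `Z` be the kernel of `Tr (g ·)` on `W` and choose `u` with `Tr u = 1`
and `Tr (g u) = 0`; the graph of `x ↦ c [u, x]` on `Z` together with the point `c [Z, Z]` spans a
plane depending only on `c` and on `g` modulo scalars (`pointPlane`).

The heart of the matter is to see when two such planes, with parameters `(c, g)` and `(c', g')`,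
share a line (`IsTraceFrame.eq_or_mul_frob_frob`). If `z ^ q - z = x` and `z₁ ^ q - z₁ = g x`, then
`w ↦ [w, x] / (x x ^ q)` turns the functionals `Tr` and `Tr (g ·)` into trace pairings with `z ^ q`
and `z₁ ^ q`. Passing to orthogonal complements, a common line above `x` means that one
two-dimensional `F`-subspace of `K` equals `c⁻¹ ⟨1, z₁ ^ q⟩` and `c'⁻¹ ⟨1, z₂ ^ q⟩` and contains
`(c⁻¹ - c'⁻¹) ⟨1, z ^ q⟩`. For `c = c'` this makes `g` and `g'` proportional, and for `c ≠ c'` it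
makes `z₁` a fractional linear function of `z`, so that `g = D / m ^ (q + 1)` with `D ∈ F` and
`m ∈ K`, whence `g ^ (q ^ 2 + 1) ∈ F`. Only about `q ^ 2` classes of `g` satisfy this relation; one
of them may be kept, so that `q ^ 3 + q + 1` classes are available (`exists_isPointParameters`).

Finally let `x₀ ^ q = -x₀`. The planes spanned by `(x₀, 0)` and the lines `0 × y L`, where `L` is the
quadratic extension of `F` inside `K`, are compatible with everything so far, and at least `q + 1`
of them are available, which brings the total to `q ^ 8 + q ^ 5 + q ^ 4`.
-/

/-! ### Frobenius and trace -/

section Frobenius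

variable (F : Type*) [Field F] [Finite F] {K : Type*} [Field K] [Algebra F K]

/-- The Frobenius endomorphism `x ↦ x ^ q` of an algebra over the field `F` with `q` elements. -/
noncomputable def frob : K →ₐ[F] K :=
  letI := Fintype.ofFinite F
  FiniteField.frobeniusAlgHom F K

theorem frob_apply (x : K) : frob F x = x ^ Nat.card F := by
  let := Fintype.ofFinite F
  simp [frob, Nat.card_eq_fintype_card]

/-- The fixed field of Frobenius is the ground field. -/
theorem exists_algebraMap_eq_of_frob_eq {x : K} (hx : frob F x = x) :
    ∃ a : F, algebraMap F K a = x := by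
  classical
  let := Fintype.ofFinite F
  have hq : 1 < Fintype.card F := Fintype.one_lt_card
  have hsplit : (Polynomial.X ^ Fintype.card F - Polynomial.X : Polynomial F) =
      ∏ a : F, (Polynomial.X - Polynomial.C a) := by
    have hmonic : (Polynomial.X ^ Fintype.card F - Polynomial.X : Polynomial F).Monic :=
      Polynomial.monic_X_pow_sub (by simpa using hq)
    rw [← Polynomial.prod_multiset_X_sub_C_of_monic_of_roots_card_eq hmonic]
    · rw [FiniteField.roots_X_pow_card_sub_X]; rfl
    · rw [FiniteField.roots_X_pow_card_sub_X, FiniteField.X_pow_card_sub_X_natDegree_eq F hq]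
      rfl
  have h := congrArg (Polynomial.aeval x) hsplit
  rw [frob_apply, Nat.card_eq_fintype_card] at hx
  simp only [map_sub, map_pow, Polynomial.aeval_X, hx, sub_self, map_prod,
    Polynomial.aeval_C] at h
  obtain ⟨a, -, ha⟩ := Finset.prod_eq_zero_iff.mp h.symm
  exact ⟨a, (sub_eq_zero.mp ha).symm⟩

/-- A `q`-polynomial `a x + b x ^ q` with two linearly independent zeros is zero. -/
theorem eq_zero_of_mul_add_mul_frob {a b x y : K} (hxy : LinearIndependent F ![x, y])
    (hx : a * x + b * frob F x = 0) (hy : a * y + b * frob F y = 0) : a = 0 ∧ b = 0 := by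
  have hy0 : y ≠ 0 := by simpa using hxy.ne_zero 1
  have hb : b = 0 := by
    by_contra hb
    have h1 : b * (frob F x * y - frob F y * x) = 0 := by linear_combination y * hx - x * hy
    have h2 : frob F (x / y) = x / y := by
      rw [map_div₀, div_eq_div_iff ((map_ne_zero _).mpr hy0) hy0]
      have := (mul_eq_zero.mp h1).resolve_left hb
      linear_combination this
    obtain ⟨c, hc⟩ := exists_algebraMap_eq_of_frob_eq F h2
    have := LinearIndependent.pair_iff.mp hxy 1 (-c) (by
      rw [one_smul, neg_smul, Algebra.smul_def, hc]; field_simp; ring)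
    exact one_ne_zero this.1
  subst hb
  have : a * y = 0 := by simpa using hy
  exact ⟨(mul_eq_zero.mp this).resolve_right hy0, rfl⟩

end Frobenius

section Quartic

variable {F : Type*} [Field F] [Finite F] {K : Type*} [Field K] [Finite K] [Algebra F K]

local notation "σ" => frob F (K := K)
local notation "tr" => Algebra.trace F K

theorem trace_frob (x : K) : tr (σ x) = tr x := by
  let := Fintype.ofFinite F
  have h := Algebra.trace_eq_of_algEquiv (FiniteField.frobeniusAlgEquivOfAlgebraic F K) x
  rw [← h]
  congr 1

theorem algebraMap_trace_quartic (hd : Module.finrank F K = 4) (x : K) :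
    algebraMap F K (tr x) = x + σ x + σ (σ x) + σ (σ (σ x)) := by
  rw [FiniteField.algebraMap_trace_eq_sum_pow, hd]
  simp only [frob_apply, Finset.sum_range_succ, Finset.sum_range_zero, ← pow_mul]
  ring_nf

theorem frob_quartic (hd : Module.finrank F K = 4) (x : K) : σ (σ (σ (σ x))) = x := by
  let := Fintype.ofFinite K
  simp only [frob_apply, ← pow_mul]
  have h : Fintype.card K = Nat.card F * Nat.card F * Nat.card F * Nat.card F := by
    rw [← Nat.card_eq_fintype_card, Module.natCard_eq_pow_finrank (K := F), hd]; ring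
  rw [← h, FiniteField.pow_card]

theorem finrank_ker_trace : Module.finrank F (LinearMap.ker (tr)) + 1 = Module.finrank F K := by
  have h := (tr).finrank_range_add_finrank_ker
  have hs := LinearMap.range_eq_top.mpr (Algebra.trace_surjective F K)
  rw [hs, finrank_top, Module.finrank_self] at h
  omega

/-- Additive Hilbert 90: elements of trace zero have the form `y ^ q - y`. -/
theorem exists_frob_sub_eq {x : K} (hx : tr x = 0) : ∃ y : K, σ y - y = x := by
  set φ : K →ₗ[F] K := (σ).toLinearMap - LinearMap.id with hφ
  have hker : Module.finrank F (LinearMap.ker φ) ≤ 1 := by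
    refine finrank_le_one ⟨1, by simp [hφ]⟩ ?_
    rintro ⟨y, hy⟩
    obtain ⟨a, ha⟩ := exists_algebraMap_eq_of_frob_eq F
      (x := y) (by simpa [hφ, sub_eq_zero] using hy)
    exact ⟨a, by ext; simp [Algebra.smul_def, ha]⟩
  have hle : LinearMap.range φ ≤ LinearMap.ker (tr) := by
    rintro _ ⟨y, rfl⟩
    simp [hφ, trace_frob]
  have h1 := φ.finrank_range_add_finrank_ker
  have h2 := finrank_ker_trace (F := F) (K := K)
  have heq := Submodule.eq_of_le_of_finrank_le hle (by omega)
  have : x ∈ LinearMap.range φ := by rw [heq]; exact hx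
  obtain ⟨y, hy⟩ := this
  exact ⟨y, by simpa [hφ] using hy⟩

end Quartic

/-! ### Orthogonal complements for the trace form -/

theorem finrank_span_pair_eq_two {F V : Type*} [Field F] [AddCommGroup V] [Module F V] {v w : V}
    (h : LinearIndependent F ![v, w]) : Module.finrank F (Submodule.span F {v, w}) = 2 := by
  have := finrank_span_eq_card h
  rwa [Matrix.range_cons, Matrix.range_cons, Matrix.range_empty, Set.union_empty,
    Set.singleton_union, Fintype.card_fin] at this

theorem exists_smul_add_smul_eq {F V : Type*} [Field F] [AddCommGroup V] [Module F V]
    {P : Submodule F V} [FiniteDimensional F P] (hP : Module.finrank F P = 2) {v w x : V}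
    (hv : v ∈ P) (hw : w ∈ P) (h : LinearIndependent F ![v, w]) (hx : x ∈ P) :
    ∃ a b : F, a • v + b • w = x := by
  have hle : Submodule.span F {v, w} ≤ P := by
    rw [Submodule.span_le]; rintro y (rfl | rfl) <;> assumption
  rw [← Submodule.eq_of_le_of_finrank_eq hle ((finrank_span_pair_eq_two h).trans hP.symm)] at hx
  exact Submodule.mem_span_pair.mp hx

section TracePerp

variable {F : Type*} [Field F] {K : Type*} [Field K] [Algebra F K]

local notation "tr" => Algebra.trace F K

/-- The orthogonal complement of `{s, t}` with respect to the trace form. -/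
noncomputable def tracePerp (F : Type*) [Field F] {K : Type*} [Field K] [Algebra F K] (s t : K) :
    Submodule F K :=
  (Algebra.traceForm F K).orthogonal (Submodule.span F {s, t})

theorem mem_tracePerp {s t x : K} : x ∈ tracePerp F s t ↔ tr (s * x) = 0 ∧ tr (t * x) = 0 := by
  simp only [tracePerp, LinearMap.BilinForm.mem_orthogonal_iff, Submodule.mem_span_pair,
    forall_exists_index, Algebra.traceForm_apply]
  constructor
  · intro h
    exact ⟨h s 1 0 (by simp), h t 0 1 (by simp)⟩
  · rintro ⟨h1, h2⟩ n a b rfl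
    simp [add_mul, h1, h2]

theorem finrank_tracePerp [Finite F] [Finite K] {s t : K} (h : LinearIndependent F ![s, t]) :
    Module.finrank F (tracePerp F s t) + 2 = Module.finrank F K := by
  have hspan := finrank_span_pair_eq_two h
  have h1 := LinearMap.BilinForm.finrank_orthogonal (traceForm_nondegenerate F K)
    (Submodule.span F {s, t})
  have h2 := Submodule.finrank_le (Submodule.span F {s, t})
  rw [tracePerp]
  omega

end TracePerp

/-! ### The Frobenius bracket -/

section Bracket

variable {F : Type*} [Field F] [Finite F] {K : Type*} [Field K] [Algebra F K]

local notation "σ" => frob F (K := K)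
local notation "tr" => Algebra.trace F K

/-- The alternating bilinear map `(u, x) ↦ u x ^ q - u ^ q x`. -/
noncomputable def frobBracket (F : Type*) [Field F] [Finite F] {K : Type*} [Field K] [Algebra F K]
    (u x : K) : K :=
  u * frob F x - frob F u * x

theorem frobBracket_add_left (u v x : K) :
    frobBracket F (u + v) x = frobBracket F u x + frobBracket F v x := by
  simp only [frobBracket, map_add]; ring

theorem frobBracket_smul_left (a : F) (u x : K) :
    frobBracket F (a • u) x = a • frobBracket F u x := by
  simp only [frobBracket, map_smul, smul_sub, smul_mul_assoc]

theorem frobBracket_add_right (u x y : K) :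
    frobBracket F u (x + y) = frobBracket F u x + frobBracket F u y := by
  simp only [frobBracket, map_add]; ring

theorem frobBracket_smul_right (a : F) (u x : K) :
    frobBracket F u (a • x) = a • frobBracket F u x := by
  simp only [frobBracket, map_smul, smul_sub, mul_smul_comm]

theorem frobBracket_self (x : K) : frobBracket F x x = 0 := by
  simp only [frobBracket]; ring

theorem frobBracket_swap (u x : K) : frobBracket F u x = -frobBracket F x u := by
  simp only [frobBracket]; ring

theorem exists_smul_eq_of_frobBracket_eq_zero {u x : K} (hx : x ≠ 0)
    (h : frobBracket F u x = 0) : ∃ a : F, a • x = u := by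
  have h2 : σ (u / x) = u / x := by
    rw [map_div₀, div_eq_div_iff ((map_ne_zero _).mpr hx) hx]
    rw [frobBracket] at h
    linear_combination -h
  obtain ⟨a, ha⟩ := exists_algebraMap_eq_of_frob_eq F h2
  exact ⟨a, by rw [Algebra.smul_def, ha, div_mul_cancel₀ _ hx]⟩

/-- The normalized bracket turns the functional `y ↦ Tr (g y)` into the trace pairing with any
solution `z` of `z ^ q - z = g x`. -/
theorem trace_frob_mul_frobBracket_div [Finite K] {x z g : K} (hx : x ≠ 0) (hz : σ z - z = g * x)
    (w : K) : tr (σ z * (frobBracket F w x / (x * σ x))) = tr (g * w) := by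
  have hx' : σ x ≠ 0 := (map_ne_zero _).mpr hx
  have h1 : σ z * (frobBracket F w x / (x * σ x)) = (g * w + z * (w / x)) - σ (z * (w / x)) := by
    rw [map_mul, map_div₀, frobBracket]
    field_simp
    linear_combination w * σ x * hz
  rw [h1, map_sub, map_add, trace_frob]
  ring

theorem trace_frobBracket_div [Finite K] {x : K} (hx : x ≠ 0) (w : K) :
    tr (frobBracket F w x / (x * σ x)) = 0 := by
  simpa using trace_frob_mul_frobBracket_div (F := F) (z := 1) (g := 0) hx (by simp) w

theorem linearIndependent_mul_frob_pair {z : K} (hz : σ z ≠ z) {m : K} (hm : m ≠ 0) :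
    LinearIndependent F ![m, m * σ z] := by
  have hz' : σ (σ z) ≠ σ z := fun h => hz ((frob F (K := K)).injective h)
  rw [LinearIndependent.pair_iff]
  intro s t h
  have h1 : algebraMap F K s + algebraMap F K t * σ z = 0 := by
    rw [Algebra.smul_def, Algebra.smul_def] at h
    refine (mul_eq_zero.mp (?_ : m * _ = 0)).resolve_left hm
    linear_combination h
  have h2 := congrArg σ h1
  simp only [map_add, map_mul, AlgHom.commutes, map_zero] at h2
  have ht : t = 0 := by
    have : algebraMap F K t * (σ (σ z) - σ z) = 0 := by linear_combination h2 - h1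
    simpa [sub_ne_zero.mpr hz'] using this
  subst ht
  exact ⟨by simpa using h1, rfl⟩

end Bracket

/-! ### Planes meeting above a common vector -/

section Collision

variable {F : Type*} [Field F] [Finite F] {K : Type*} [Field K] [Finite K] [Algebra F K]

local notation "σ" => frob F (K := K)
local notation "tr" => Algebra.trace F K

/-- `x`, `y`, `u` lie in the hyperplane `Tr (g ·) = 0`, with `Tr x = Tr y = 0` and `Tr u = 1`. -/
structure IsTraceFrame (F : Type*) [Field F] {K : Type*} [Field K] [Algebra F K]
    (g x y u : K) : Prop where
  x_zero : Algebra.trace F K x = 0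
  y_zero : Algebra.trace F K y = 0
  u_one : Algebra.trace F K u = 1
  mul_x : Algebra.trace F K (g * x) = 0
  mul_y : Algebra.trace F K (g * y) = 0
  mul_u : Algebra.trace F K (g * u) = 0

/-- If `g m ^ (q + 1)` lies in the ground field, so does `g ^ (q ^ 2 + 1)`, because the product of
`m ^ (q + 1)` and its conjugate under `x ↦ x ^ (q ^ 2)` is the norm of `m`. -/
theorem exists_algebraMap_eq_mul_frob_frob (hd : Module.finrank F K = 4) {g m : K} (hm : m ≠ 0)
    {D : F} (h : g * (m * σ m) = algebraMap F K D) :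
    ∃ a : F, algebraMap F K a = g * σ (σ g) := by
  have hN : σ (m * σ m * (σ (σ m) * σ (σ (σ m)))) = m * σ m * (σ (σ m) * σ (σ (σ m))) := by
    simp only [map_mul, frob_quartic hd]; ring
  obtain ⟨n, hn⟩ := exists_algebraMap_eq_of_frob_eq F hN
  have h' := congrArg σ (congrArg σ h)
  simp only [map_mul, AlgHom.commutes] at h'
  have hn0 : m * σ m * (σ (σ m) * σ (σ (σ m))) ≠ 0 := by
    simp only [ne_eq, mul_eq_zero, map_eq_zero, hm, or_self, not_false_eq_true]
  refine ⟨D * D / n, ?_⟩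
  rw [map_div₀, hn, div_eq_iff hn0, map_mul]
  linear_combination (-(σ (σ g) * (σ (σ m) * σ (σ (σ m))))) * h - algebraMap F K D * h'

variable {x g g' y y' u u' c c' : K}

/-- The dichotomy behind the code: two planes through a common point which meet above `x` either
have the same parameters, or satisfy a relation forcing `g * g ^ (q ^ 2)` into the ground field. -/
theorem IsTraceFrame.eq_or_mul_frob_frob (hd : Module.finrank F K = 4) (hx : x ≠ 0)
    (hg : g ≠ 0) (hc : c ≠ 0) (hf : IsTraceFrame F g x y u) (hf' : IsTraceFrame F g' x y' u')
    (hyx : frobBracket F y x ≠ 0)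
    (hy : c * frobBracket F y x = c' * frobBracket F y' x)
    (hu : c * frobBracket F u x = c' * frobBracket F u' x) :
    (c = c' ∧ ∃ a : F, a • g = g') ∨
      (c ≠ c' ∧ ∃ a : F, algebraMap F K a = g * σ (σ g)) := by
  have hc' : c' ≠ 0 := by
    rintro rfl
    rw [zero_mul] at hy
    exact mul_ne_zero hc hyx hy
  have hx' : σ x ≠ 0 := (map_ne_zero _).mpr hx
  obtain ⟨z, hz⟩ := exists_frob_sub_eq (F := F) hf.x_zero
  obtain ⟨z₁, hz₁⟩ := exists_frob_sub_eq (F := F) hf.mul_x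
  obtain ⟨z₂, hz₂⟩ := exists_frob_sub_eq (F := F) hf'.mul_x
  have hz1 : σ z - z = 1 * x := by rw [hz, one_mul]
  have hzne : σ z ≠ z := fun h => hx (by rw [← hz, h, sub_self])
  have hzne₁ : σ z₁ ≠ z₁ := fun h => mul_ne_zero hg hx (by rw [← hz₁, h, sub_self])
  set φ : K → K := fun w => frobBracket F w x / (x * σ x) with hφ
  have hφ0 : ∀ w, tr (φ w) = 0 := trace_frobBracket_div hx
  have hφz : ∀ w, tr (σ z * φ w) = tr w := fun w => by
    rw [trace_frob_mul_frobBracket_div hx hz1, one_mul]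
  have hφ1 : ∀ w, tr (σ z₁ * φ w) = tr (g * w) := trace_frob_mul_frobBracket_div hx hz₁
  have hφ2 : ∀ w, tr (σ z₂ * φ w) = tr (g' * w) := trace_frob_mul_frobBracket_div hx hz₂
  have ht : c' * φ u' = c * φ u := by
    simp only [hφ, ← mul_div_assoc, hu]
  have hp : c' * φ y' = c * φ y := by
    simp only [hφ, ← mul_div_assoc, hy]
  have hind : LinearIndependent F ![c * φ u, c * φ y] := by
    rw [LinearIndependent.pair_iff]
    intro a b h
    have h1 : frobBracket F (a • u + b • y) x = 0 := by
      have h2 : c / (x * σ x) * frobBracket F (a • u + b • y) x = 0 := by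
        rw [frobBracket_add_left, frobBracket_smul_left, frobBracket_smul_left, ← h]
        simp only [hφ, Algebra.smul_def]
        ring
      exact (mul_eq_zero.mp h2).resolve_left (div_ne_zero hc (mul_ne_zero hx hx'))
    obtain ⟨r, hr⟩ := exists_smul_eq_of_frobBracket_eq_zero hx h1
    have ha := congrArg tr hr
    simp only [map_smul, map_add, hf.x_zero, hf.y_zero, hf.u_one, add_zero, smul_eq_mul, mul_one,
      mul_zero] at ha
    subst a
    rw [zero_smul, zero_add, frobBracket_smul_left] at h1
    exact ⟨rfl, (smul_eq_zero.mp h1).resolve_right hyx⟩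
  have hP : Module.finrank F (tracePerp F (c * φ u) (c * φ y)) = 2 := by
    have := finrank_tracePerp hind; omega
  -- `P` is the two-dimensional subspace which all the parameters of both planes have to lie in.
  set P := tracePerp F (c * φ u) (c * φ y) with hPdef
  have he : c⁻¹ ∈ P := by
    rw [mem_tracePerp]
    constructor
    · rw [mul_right_comm, mul_inv_cancel₀ hc, one_mul, hφ0]
    · rw [mul_right_comm, mul_inv_cancel₀ hc, one_mul, hφ0]
  have he' : c'⁻¹ ∈ P := by
    rw [mem_tracePerp, ← ht, ← hp]
    constructor
    · rw [mul_right_comm, mul_inv_cancel₀ hc', one_mul, hφ0]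
    · rw [mul_right_comm, mul_inv_cancel₀ hc', one_mul, hφ0]
  have hcancel : ∀ {d : K}, d ≠ 0 → ∀ s w, d * w * (d⁻¹ * s) = s * w := by
    intro d hd s w
    field_simp
  have he₁ : c⁻¹ * σ z₁ ∈ P := by
    rw [mem_tracePerp, hcancel hc, hcancel hc, hφ1, hφ1]
    exact ⟨hf.mul_u, hf.mul_y⟩
  have he₂ : c'⁻¹ * σ z₂ ∈ P := by
    rw [mem_tracePerp, ← ht, ← hp, hcancel hc', hcancel hc', hφ2, hφ2]
    exact ⟨hf'.mul_u, hf'.mul_y⟩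
  have hm : (c⁻¹ - c'⁻¹) * σ z ∈ P := by
    rw [mem_tracePerp, sub_mul, mul_sub, mul_sub, map_sub, map_sub]
    constructor
    · rw [hcancel hc, hφz, ← ht, hcancel hc', hφz, hf.u_one, hf'.u_one, sub_self]
    · rw [hcancel hc, hφz, ← hp, hcancel hc', hφz, hf.y_zero, hf'.y_zero, sub_self]
  have hinj := (frob F (K := K)).injective
  by_cases hcc : c = c'
  · subst hcc
    refine Or.inl ⟨rfl, ?_⟩
    obtain ⟨a, b, hab⟩ := exists_smul_add_smul_eq hP he he₁
      (linearIndependent_mul_frob_pair hzne₁ (inv_ne_zero hc)) he₂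
    have h1 : σ (algebraMap F K a + algebraMap F K b * z₁) = σ z₂ := by
      simp only [map_add, map_mul, AlgHom.commutes]
      rw [Algebra.smul_def, Algebra.smul_def] at hab
      field_simp at hab
      linear_combination hab
    have h2 := hinj h1
    refine ⟨b, mul_right_cancel₀ hx ?_⟩
    rw [Algebra.smul_def, ← hz₂, ← h2, mul_assoc, ← hz₁]
    simp only [map_add, map_mul, AlgHom.commutes]
    ring
  · refine Or.inr ⟨hcc, ?_⟩
    have hm0 : c⁻¹ - c'⁻¹ ≠ 0 := by
      rw [sub_ne_zero]; exact fun h => hcc (inv_injective h)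
    have hbasis := linearIndependent_mul_frob_pair hzne hm0 (F := F)
    have hm1 : c⁻¹ - c'⁻¹ ∈ P := P.sub_mem he he'
    obtain ⟨d, k, hdk⟩ := exists_smul_add_smul_eq hP hm1 hm hbasis he
    obtain ⟨b, a, hba⟩ := exists_smul_add_smul_eq hP hm1 hm hbasis he₁
    simp only [Algebra.smul_def] at hdk hba
    -- The two bases of `P` express `z₁` as the fractional linear function `(b + a z) / M` of `z`.
    set M := algebraMap F K d + algebraMap F K k * z with hM
    have hσM : σ M = algebraMap F K d + algebraMap F K k * σ z := by
      simp only [hM, map_add, map_mul, AlgHom.commutes]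
    have hcM : (c⁻¹ - c'⁻¹) * σ M = c⁻¹ := by rw [hσM]; linear_combination hdk
    have hM0 : M ≠ 0 := by
      intro h
      rw [h, map_zero, mul_zero] at hcM
      exact inv_ne_zero hc hcM.symm
    have h1 : σ (M * z₁) = σ (algebraMap F K b + algebraMap F K a * z) := by
      refine mul_left_cancel₀ hm0 ?_
      rw [map_mul, ← mul_assoc, hcM, ← hba]
      simp only [map_add, map_mul, AlgHom.commutes]
      ring
    have h2 := hinj h1
    have h3 : σ M * σ z₁ = algebraMap F K b + algebraMap F K a * σ z := by
      rw [← map_mul, h1]; simp only [map_add, map_mul, AlgHom.commutes]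
    refine exists_algebraMap_eq_mul_frob_frob hd hM0 (D := a * d - b * k) ?_
    refine mul_right_cancel₀ hx ?_
    rw [map_sub, map_mul, map_mul]
    have : g * (M * σ M) * x = M * σ M * (σ z₁ - z₁) := by rw [hz₁]; ring
    rw [this, ← hz]
    linear_combination M * h3 - σ M * h2 + (algebraMap F K b + algebraMap F K a * σ z) * hM
      - (algebraMap F K b + algebraMap F K a * z) * hσM

/-- Frames for which the relation is excluded for both, or which share the same `g`, do not
collide. -/
theorem IsTraceFrame.eq_of_collision (hd : Module.finrank F K = 4) (hx : x ≠ 0)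
    (hg : g ≠ 0) (hg' : g' ≠ 0) (hc : c ≠ 0) (hf : IsTraceFrame F g x y u)
    (hf' : IsTraceFrame F g' x y' u') (hyx : frobBracket F y x ≠ 0)
    (hy : c * frobBracket F y x = c' * frobBracket F y' x)
    (hu : c * frobBracket F u x = c' * frobBracket F u' x)
    (hbad : (∃ a : F, algebraMap F K a = g * σ (σ g)) →
      (∃ a : F, algebraMap F K a = g' * σ (σ g')) → ∃ a : F, a • g = g')
    (hind : LinearIndependent F ![1, g]) :
    c = c' ∧ ∃ a : F, a • g = g' := by
  rcases hf.eq_or_mul_frob_frob hd hx hg hc hf' hyx hy hu with h | ⟨hcc, h⟩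
  · exact h
  have hc' : c' ≠ 0 := by
    rintro rfl
    rw [zero_mul] at hy
    exact mul_ne_zero hc hyx hy
  have hyx' : frobBracket F y' x ≠ 0 := by
    intro h
    rw [h, mul_zero] at hy
    exact mul_ne_zero hc hyx hy
  have h' : ∃ a : F, algebraMap F K a = g' * σ (σ g') := by
    rcases hf'.eq_or_mul_frob_frob hd hx hg' hc' hf hyx' hy.symm hu.symm with ⟨h, -⟩ | ⟨-, h⟩
    · exact absurd h.symm hcc
    · exact h
  obtain ⟨a, rfl⟩ := hbad h h'
  refine ⟨?_, a, rfl⟩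
  have ha : a ≠ 0 := by rintro rfl; simp at hg'
  -- `x` and `y` span the plane `Tr = Tr (g ·) = 0`, so `y'` is a multiple of `y` modulo `x`.
  have hP : Module.finrank F (tracePerp F 1 g) = 2 := by have := finrank_tracePerp hind; omega
  have hxy : LinearIndependent F ![x, y] := by
    rw [LinearIndependent.pair_iff]
    intro r s h
    have h1 := congrArg (fun w => frobBracket F w x) h
    simp only [frobBracket_add_left, frobBracket_smul_left, frobBracket_self, smul_zero,
      zero_add] at h1
    have hs : s = 0 := by
      rcases smul_eq_zero.mp (h1.trans (by simp [frobBracket])) with h | h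
      · exact h
      · exact absurd h hyx
    subst hs
    rw [zero_smul, add_zero] at h
    exact ⟨(smul_eq_zero.mp h).resolve_right hx, rfl⟩
  have hy'g : tr (g * y') = 0 := by
    have := hf'.mul_y
    rw [smul_mul_assoc, map_smul] at this
    exact (smul_eq_zero.mp this).resolve_left ha
  obtain ⟨r, s, hrs⟩ := exists_smul_add_smul_eq hP
    (mem_tracePerp.mpr ⟨by simpa using hf.x_zero, hf.mul_x⟩)
    (mem_tracePerp.mpr ⟨by simpa using hf.y_zero, hf.mul_y⟩) hxy
    (mem_tracePerp.mpr ⟨by simpa using hf'.y_zero, hy'g⟩)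
  have hcs : c = algebraMap F K s * c' := by
    refine mul_right_cancel₀ hyx ?_
    rw [hy, ← hrs, frobBracket_add_left, frobBracket_smul_left, frobBracket_smul_left,
      frobBracket_self, smul_zero, zero_add, Algebra.smul_def]
    ring
  have h0 : frobBracket F (u' - s • u) x = 0 := by
    refine (mul_eq_zero.mp (?_ : c' * _ = 0)).resolve_left hc'
    have h1 : frobBracket F (u' - s • u) x = frobBracket F u' x - s • frobBracket F u x := by
      rw [sub_eq_add_neg, ← neg_smul, frobBracket_add_left, frobBracket_smul_left, neg_smul,
        ← sub_eq_add_neg]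
    rw [h1, Algebra.smul_def]
    rw [hcs] at hu
    linear_combination -hu
  obtain ⟨t, ht⟩ := exists_smul_eq_of_frobBracket_eq_zero hx h0
  have := congrArg tr ht
  rw [map_smul, map_sub, map_smul, hf.x_zero, hf.u_one, hf'.u_one, smul_zero, smul_eq_mul,
    mul_one] at this
  rw [hcs, ← sub_eq_zero.mp this.symm, map_one, one_mul]

end Collision

/-! ### Plane codes in an arbitrary ambient space -/

section PlaneCode

variable {F : Type*} [Field F]

theorem four_le_subspaceDist_iff {E : Type*} [AddCommGroup E] [Module F E]
    [FiniteDimensional F E] {U W : Submodule F E} (hU : Module.finrank F U = 3)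
    (hW : Module.finrank F W = 3) :
    4 ≤ subspaceDist U W ↔ Module.finrank F ↥(U ⊓ W) ≤ 1 := by
  have h := Submodule.finrank_sup_add_finrank_inf_eq U W
  rw [subspaceDist]
  omega

theorem card_le_maxCodeSize [Finite F] {v k d : ℕ} {C : Finset (Submodule F (Fin v → F))}
    (hC : IsConstDimCode F v d k C) : C.card ≤ maxCodeSize F v d k :=
  le_csSup (bddAbove_constDimCode_card F v d k) ⟨C, hC, rfl⟩

/-- A family of planes inside a `v`-dimensional subspace, any two of which with a common line have
the same index, is a code in `F ^ v`. -/
theorem natCard_le_maxCodeSize [Finite F] {E : Type*} [AddCommGroup E] [Module F E]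
    [FiniteDimensional F E] {v : ℕ} {P : Submodule F E} (hP : Module.finrank F P = v)
    {ι : Type*} [Finite ι] (f : ι → Submodule F E) (hle : ∀ i, f i ≤ P)
    (h3 : ∀ i, Module.finrank F (f i) = 3)
    (hf : ∀ i j, 2 ≤ Module.finrank F ↥(f i ⊓ f j) → i = j) :
    Nat.card ι ≤ maxCodeSize F v 4 3 := by
  classical
  have := Fintype.ofFinite ι
  let e : P ≃ₗ[F] (Fin v → F) := LinearEquiv.ofFinrankEq _ _ (by simp [hP])
  let ψ : (Fin v → F) →ₗ[F] E := P.subtype ∘ₗ e.symm.toLinearMap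
  have hψ : Function.Injective ψ := P.subtype_injective.comp e.symm.injective
  have hrange : LinearMap.range ψ = P := by
    rw [LinearMap.range_comp, LinearEquiv.range, Submodule.map_top, Submodule.range_subtype]
  have hfin : ∀ Q ≤ P, Module.finrank F (Q.comap ψ) = Module.finrank F Q := by
    intro Q hQ
    rw [(Submodule.equivMapOfInjective ψ hψ (Q.comap ψ)).finrank_eq, Submodule.map_comap_eq,
      hrange, inf_eq_right.mpr hQ]
  have hinj : Function.Injective fun i => (f i).comap ψ := by
    intro i j hij
    refine hf i j ?_
    rw [← hfin _ (inf_le_left.trans (hle i)), Submodule.comap_inf]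
    simp only at hij
    rw [hij, inf_idem, hfin _ (hle j), h3]
    norm_num
  have hcode : IsConstDimCode F v 4 3 (Finset.univ.image fun i => (f i).comap ψ) := by
    constructor
    · intro U hU
      obtain ⟨i, -, rfl⟩ := Finset.mem_image.mp hU
      rw [hfin _ (hle i), h3]
    · intro U hU W hW hne
      obtain ⟨i, -, rfl⟩ := Finset.mem_image.mp hU
      obtain ⟨j, -, rfl⟩ := Finset.mem_image.mp hW
      rw [four_le_subspaceDist_iff (by rw [hfin _ (hle i), h3]) (by rw [hfin _ (hle j), h3]),
        ← Submodule.comap_inf, hfin _ (inf_le_left.trans (hle i))]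
      by_contra! h
      exact hne (by rw [hf i j h])
  have := card_le_maxCodeSize hcode
  rwa [Finset.card_image_of_injective _ hinj, Finset.card_univ, ← Nat.card_eq_fintype_card] at this

theorem exists_linearIndependent_pair_of_two_le_finrank {E : Type*} [AddCommGroup E] [Module F E]
    {D : Submodule F E} (h : 2 ≤ Module.finrank F D) :
    ∃ v ∈ D, ∃ w ∈ D, LinearIndependent F ![v, w] := by
  have : Nontrivial D := Module.nontrivial_of_finrank_pos (R := F) (by omega)
  obtain ⟨x, hx⟩ := exists_ne (0 : D)
  obtain ⟨y, hy⟩ := exists_linearIndependent_pair_of_one_lt_finrank (R := F) h hx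
  refine ⟨x, x.2, y, y.2, ?_⟩
  rw [LinearIndependent.pair_iff] at hy ⊢
  intro s t hst
  exact hy s t (Subtype.ext (by simpa using hst))

/-- A subspace of `E × M` of dimension at least two contains a graph-like pair of vectors, or
meets `0 × M` in a point and projects nontrivially to `E`, or meets `0 × M` in a line. -/
theorem exists_pair_of_two_le_finrank {E M : Type*} [AddCommGroup E] [Module F E]
    [AddCommGroup M] [Module F M] {D : Submodule F (E × M)} (h : 2 ≤ Module.finrank F D) :
    (∃ x x' t t', (x, t) ∈ D ∧ (x', t') ∈ D ∧ LinearIndependent F ![x, x']) ∨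
    (∃ p, p ≠ 0 ∧ ((0 : E), p) ∈ D ∧ ∃ x t, x ≠ 0 ∧ (x, t) ∈ D) ∨
    ∃ p p', ((0 : E), p) ∈ D ∧ ((0 : E), p') ∈ D ∧ LinearIndependent F ![p, p'] := by
  obtain ⟨⟨x, t⟩, hv, ⟨x', t'⟩, hw, hvw⟩ := exists_linearIndependent_pair_of_two_le_finrank h
  by_cases hxx : LinearIndependent F ![x, x']
  · exact Or.inl ⟨x, x', t, t', hv, hw, hxx⟩
  refine Or.inr ?_
  by_cases h0 : x = 0 ∧ x' = 0
  · obtain ⟨rfl, rfl⟩ := h0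
    refine Or.inr ⟨t, t', hv, hw, ?_⟩
    rw [LinearIndependent.pair_iff] at hvw ⊢
    exact fun r s hrs => hvw r s (by simpa using hrs)
  · left
    rw [LinearIndependent.pair_iff] at hxx hvw
    push Not at hxx
    obtain ⟨r, s, hrs, hne⟩ := hxx
    refine ⟨r • t + s • t', ?_, ?_, ?_⟩
    · intro ht
      have := hvw r s (by simp [hrs, ht])
      exact hne this.1 this.2
    · have := D.add_mem (D.smul_mem r hv) (D.smul_mem s hw)
      simpa [hrs] using this
    · by_cases hx : x = 0
      · exact ⟨x', t', fun h => h0 ⟨hx, h⟩, hw⟩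
      · exact ⟨x, t, hx, hv⟩

/-- The graph of a linear map defined on a subspace. -/
def graphOn {E M : Type*} [AddCommGroup E] [Module F E] [AddCommGroup M] [Module F M]
    (U : Submodule F E) (f : U →ₗ[F] M) : Submodule F (E × M) :=
  LinearMap.range (U.subtype.prod f)

section GraphOn

variable {E M : Type*} [AddCommGroup E] [Module F E] [AddCommGroup M] [Module F M]
  {U : Submodule F E} {f : U →ₗ[F] M}

theorem mem_graphOn {x : E} {t : M} : (x, t) ∈ graphOn U f ↔ ∃ h : x ∈ U, f ⟨x, h⟩ = t := by
  constructor
  · rintro ⟨a, ha⟩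
    obtain ⟨h1, h2⟩ := Prod.mk.inj ha
    exact ⟨h1 ▸ a.2, by rw [← h2]; congr 1; exact Subtype.ext h1.symm⟩
  · rintro ⟨h, rfl⟩; exact ⟨⟨x, h⟩, rfl⟩

theorem finrank_graphOn : Module.finrank F (graphOn U f) = Module.finrank F U := by
  refine LinearMap.finrank_range_of_inj fun a b h => ?_
  simpa using congrArg Prod.fst h

theorem exists_pair_of_two_le_finrank_graphOn_inf {D : Submodule F (E × M)}
    (h : 2 ≤ Module.finrank F ↥(graphOn U f ⊓ D)) :
    ∃ x x' : U, LinearIndependent F ![(x : E), x'] ∧ ((x : E), f x) ∈ D ∧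
      ((x' : E), f x') ∈ D := by
  have h0 : ∀ {p}, ((0 : E), p) ∈ graphOn U f → p = 0 := by
    intro p hp
    obtain ⟨h, rfl⟩ := mem_graphOn.mp hp
    exact map_zero f
  rcases exists_pair_of_two_le_finrank h with
    ⟨x, x', t, t', hx, hx', hind⟩ | ⟨p, hp, hpD, -⟩ | ⟨p, p', hpD, -, hind⟩
  · obtain ⟨hU, rfl⟩ := mem_graphOn.mp hx.1
    obtain ⟨hU', rfl⟩ := mem_graphOn.mp hx'.1
    exact ⟨⟨x, hU⟩, ⟨x', hU'⟩, hind, hx.2, hx'.2⟩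
  · exact absurd (h0 hpD.1) hp
  · exact absurd (h0 hpD.1) (by simpa using hind.ne_zero 0)

end GraphOn

theorem exists_injective_of_finrank_le {E M : Type*} [AddCommGroup E] [Module F E]
    [FiniteDimensional F E] [AddCommGroup M] [Module F M] [FiniteDimensional F M]
    (h : Module.finrank F E ≤ Module.finrank F M) :
    ∃ f : E →ₗ[F] M, Function.Injective f := by
  let b := Module.finBasis F E
  let c := Module.finBasis F M
  have hc : LinearIndependent F fun i => c (Fin.castLE h i) :=
    c.linearIndependent.comp _ (Fin.castLE_injective h)
  rw [linearIndependent_iff_injective_fintypeLinearCombination] at hc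
  exact ⟨Fintype.linearCombination F (fun i => c (Fin.castLE h i)) ∘ₗ b.equivFun.toLinearMap,
    hc.comp b.equivFun.injective⟩

end PlaneCode

/-! ### Rank-distance codes of binomials and the linkage bound -/

section Binomial

variable {F : Type*} [Field F] [Finite F] {K : Type*} [Field K] [Algebra F K]

/-- The linear map `x ↦ a x + b x ^ q`. -/
noncomputable def frobBinomial (F : Type*) [Field F] [Finite F] {K : Type*} [Field K] [Algebra F K]
    (a b : K) : K →ₗ[F] K :=
  LinearMap.mulLeft F a + LinearMap.mulLeft F b ∘ₗ (frob F).toLinearMap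

theorem frobBinomial_apply (a b x : K) : frobBinomial F a b x = a * x + b * frob F x := by
  simp [frobBinomial]

theorem eq_of_frobBinomial_eq {a b a' b' x y : K} (hxy : LinearIndependent F ![x, y])
    (hx : frobBinomial F a b x = frobBinomial F a' b' x)
    (hy : frobBinomial F a b y = frobBinomial F a' b' y) : a = a' ∧ b = b' := by
  rw [frobBinomial_apply, frobBinomial_apply] at hx hy
  have := eq_zero_of_mul_add_mul_frob F (a := a - a') (b := b - b') hxy
    (by linear_combination hx) (by linear_combination hy)
  exact ⟨sub_eq_zero.mp this.1, sub_eq_zero.mp this.2⟩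

theorem exists_field_finrank_eq (F : Type*) [Field F] [Finite F] {j : ℕ} (hj : j ≠ 0) :
    ∃ (K : Type) (_ : Field K) (_ : Finite K) (_ : Algebra F K), Module.finrank F K = j := by
  obtain ⟨p, hp⟩ := CharP.exists F
  have : Fact p.Prime := ⟨CharP.char_is_prime F p⟩
  have : NeZero j := ⟨hj⟩
  exact ⟨FiniteField.Extension F p j, inferInstance, inferInstance, inferInstance,
    FiniteField.finrank_extension F p j⟩

/-- Linkage: a plane code can be extended by the graphs of a maximum rank distance code. -/
theorem maxCodeSize_mul_le (F : Type*) [Field F] [Finite F] (m : ℕ) {j : ℕ} (hj : 3 ≤ j) :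
    maxCodeSize F m 4 3 * Nat.card F ^ (2 * j) ≤ maxCodeSize F (m + j) 4 3 := by
  obtain ⟨K, _, _, _, hK⟩ := exists_field_finrank_eq F (j := j) (by omega)
  obtain ⟨C, hC, hcard⟩ := exists_isConstDimCode_card_eq F m 4 3
  have hφ : ∀ U : C, ∃ φ : U.1 →ₗ[F] K, Function.Injective φ := fun U =>
    exists_injective_of_finrank_le (by rw [hC.1 U.1 U.2, hK]; exact hj)
  choose φ hφ using hφ
  have hmain := natCard_le_maxCodeSize (F := F) (E := (Fin m → F) × K) (v := m + j) (P := ⊤)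
    (by rw [finrank_top, Module.finrank_prod, Module.finrank_fin_fun, hK])
    (ι := C × K × K) (fun i => graphOn i.1.1 (frobBinomial F i.2.1 i.2.2 ∘ₗ φ i.1))
    (fun i => le_top) (fun i => by rw [finrank_graphOn, hC.1 i.1.1 i.1.2]) ?_
  · have h1 : Nat.card K = Nat.card F ^ j := by rw [Module.natCard_eq_pow_finrank (K := F), hK]
    rw [Nat.card_prod, Nat.card_prod, h1, Nat.card_eq_fintype_card, Fintype.card_coe, hcard] at hmain
    calc _ = _ := by ring
      _ ≤ _ := hmain
  · rintro ⟨⟨U, hU⟩, a, b⟩ ⟨⟨U', hU'⟩, a', b'⟩ h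
    obtain ⟨x, x', hind, hx, hx'⟩ := exists_pair_of_two_le_finrank_graphOn_inf h
    obtain ⟨hxU, hxe⟩ := mem_graphOn.mp hx
    obtain ⟨hxU', hxe'⟩ := mem_graphOn.mp hx'
    have hUU : U = U' := by
      by_contra hne
      have h1 := (four_le_subspaceDist_iff (hC.1 U hU) (hC.1 U' hU')).mp (hC.2 U hU U' hU' hne)
      have h2 : Submodule.span F {(x : Fin m → F), (x' : Fin m → F)} ≤ U ⊓ U' := by
        rw [Submodule.span_le]
        rintro y (rfl | rfl)
        · exact ⟨x.2, hxU⟩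
        · exact ⟨x'.2, hxU'⟩
      have h3 := Submodule.finrank_mono h2
      rw [finrank_span_pair_eq_two hind] at h3
      omega
    subst hUU
    have hind' : LinearIndependent F ![φ ⟨U, hU⟩ x, φ ⟨U, hU⟩ x'] := by
      rw [LinearIndependent.pair_iff] at hind ⊢
      intro r s hrs
      refine hind r s ?_
      rw [← map_smul, ← map_smul, ← map_add] at hrs
      have := hφ ⟨U, hU⟩ (hrs.trans (map_zero _).symm)
      simpa using congrArg Subtype.val this
    obtain ⟨rfl, rfl⟩ := eq_of_frobBinomial_eq hind' hxe.symm hxe'.symm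
    rfl

end Binomial

/-! ### Planes meeting the special subspace in a point -/

section PointPlane

variable {F : Type*} [Field F] [Finite F] {K : Type*} [Field K] [Finite K] [Algebra F K]

local notation "σ" => frob F (K := K)
local notation "tr" => Algebra.trace F K

/-- The span of `(x₁, c [u, x₁])`, `(x₂, c [u, x₂])` and the point `(0, c [x₁, x₂])`. Up to
multiples of the last vector, the map `x ↦ c [u, x]` depends only on `u` modulo `x₁, x₂`. -/
noncomputable def pointPlane (F : Type*) [Field F] [Finite F] {K : Type*} [Field K] [Algebra F K]
    (c x₁ x₂ u : K) : Submodule F (K × K) :=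
  Submodule.span F {(x₁, c * frobBracket F u x₁), (x₂, c * frobBracket F u x₂),
    (0, c * frobBracket F x₁ x₂)}

omit [Finite K] in
theorem frobBracket_ne_zero {x y : K} (h : LinearIndependent F ![x, y]) :
    frobBracket F x y ≠ 0 := by
  intro h0
  have hy : y ≠ 0 := by simpa using h.ne_zero 1
  obtain ⟨a, ha⟩ := exists_smul_eq_of_frobBracket_eq_zero hy h0
  have := LinearIndependent.pair_iff.mp h 1 (-a) (by rw [← ha]; module)
  exact one_ne_zero this.1

/-- Frames exist: the common kernel of `Tr` and `Tr (g ·)` is two-dimensional, and `Tr` does not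
vanish on the three-dimensional kernel of `Tr (g ·)`. -/
theorem exists_isTraceFrame (hd : Module.finrank F K = 4) {g : K}
    (hg : LinearIndependent F ![1, g]) :
    ∃ x₁ x₂ u : K, LinearIndependent F ![x₁, x₂] ∧ IsTraceFrame F g x₁ x₂ u := by
  have hP : Module.finrank F (tracePerp F 1 g) = 2 := by have := finrank_tracePerp hg; omega
  obtain ⟨x₁, hx₁, x₂, hx₂, hind⟩ := exists_linearIndependent_pair_of_two_le_finrank hP.ge
  set ψ : K →ₗ[F] F := tr ∘ₗ LinearMap.mulLeft F g
  have hker : 3 ≤ Module.finrank F (LinearMap.ker ψ) := by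
    have h1 := ψ.finrank_range_add_finrank_ker
    have h2 := Submodule.finrank_le (LinearMap.range ψ)
    rw [Module.finrank_self] at h2
    omega
  obtain ⟨v, hv, hv'⟩ : ∃ v ∈ LinearMap.ker ψ, v ∉ tracePerp F 1 g := by
    by_contra! h
    have := Submodule.finrank_mono (show LinearMap.ker ψ ≤ tracePerp F 1 g from h)
    omega
  have hv0 : tr (g * v) = 0 := hv
  have hv1 : tr v ≠ 0 := fun h => hv' (mem_tracePerp.mpr ⟨by rwa [one_mul], hv0⟩)
  rw [mem_tracePerp, one_mul] at hx₁ hx₂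
  refine ⟨x₁, x₂, (tr v)⁻¹ • v, hind, hx₁.1, hx₂.1, ?_, hx₁.2, hx₂.2, ?_⟩
  · rw [map_smul, smul_eq_mul, inv_mul_cancel₀ hv1]
  · rw [mul_smul_comm, map_smul, hv0, smul_zero]

variable {c g x₁ x₂ u : K}

omit [Finite K] in
theorem mem_pointPlane {x t : K} : (x, t) ∈ pointPlane F c x₁ x₂ u ↔
    ∃ r s w : F, x = r • x₁ + s • x₂ ∧
      t = c * (frobBracket F u x + w • frobBracket F x₁ x₂) := by
  rw [pointPlane, Submodule.mem_span_triple]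
  refine exists_congr fun r => exists_congr fun s => exists_congr fun w => ?_
  simp only [Prod.smul_mk, Prod.mk_add_mk, Prod.mk.injEq, smul_zero, add_zero]
  constructor
  · rintro ⟨rfl, rfl⟩
    refine ⟨rfl, ?_⟩
    simp only [frobBracket_add_right, frobBracket_smul_right, mul_add, mul_smul_comm]
  · rintro ⟨rfl, rfl⟩
    refine ⟨rfl, ?_⟩
    simp only [frobBracket_add_right, frobBracket_smul_right, mul_add, mul_smul_comm]

theorem finrank_pointPlane (hc : c ≠ 0) (h : LinearIndependent F ![x₁, x₂]) :
    Module.finrank F (pointPlane F c x₁ x₂ u) = 3 := by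
  have hδ := mul_ne_zero hc (frobBracket_ne_zero h)
  have hli : LinearIndependent F ![(x₁, c * frobBracket F u x₁), (x₂, c * frobBracket F u x₂),
      ((0 : K), c * frobBracket F x₁ x₂)] := by
    rw [Fintype.linearIndependent_iff]
    intro a ha
    simp only [Fin.sum_univ_three, Matrix.cons_val_zero, Matrix.cons_val_one, Matrix.cons_val,
      Prod.smul_mk, Prod.mk_add_mk, smul_zero, add_zero, Prod.mk_eq_zero] at ha
    obtain ⟨h0, h1⟩ := LinearIndependent.pair_iff.mp h _ _ ha.1
    have h2 := ha.2
    rw [h0, h1, zero_smul, zero_smul, zero_add, zero_add] at h2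
    have h2 := (smul_eq_zero.mp h2).resolve_right hδ
    intro i
    fin_cases i <;> assumption
  have := finrank_span_eq_card hli
  rwa [Matrix.range_cons, Matrix.range_cons, Matrix.range_cons, Matrix.range_empty,
    Set.union_empty, Set.singleton_union, Set.singleton_union, Fintype.card_fin] at this

variable (hf : IsTraceFrame F g x₁ x₂ u)

omit [Finite K] in
include hf in
theorem IsTraceFrame.mem_tracePerp_of_mem_pointPlane {x t : K}
    (h : (x, t) ∈ pointPlane F c x₁ x₂ u) : x ∈ tracePerp F 1 g := by
  obtain ⟨r, s, w, rfl, -⟩ := mem_pointPlane.mp h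
  refine Submodule.add_mem _ (Submodule.smul_mem _ _ ?_) (Submodule.smul_mem _ _ ?_)
  · exact mem_tracePerp.mpr ⟨by rw [one_mul]; exact hf.x_zero, hf.mul_x⟩
  · exact mem_tracePerp.mpr ⟨by rw [one_mul]; exact hf.y_zero, hf.mul_y⟩

omit [Finite K] in
include hf in
/-- Bracketing the plane `⟨x₁, x₂⟩` with any of its nonzero vectors gives the same point
`⟨[x₁, x₂]⟩`. -/
theorem IsTraceFrame.exists_frobBracket_eq_smul {r s : F} (h : r • x₁ + s • x₂ ≠ 0) (w : F) :
    ∃ z ∈ tracePerp F 1 g,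
      frobBracket F z (r • x₁ + s • x₂) = w • frobBracket F x₁ x₂ := by
  have h1 : x₁ ∈ tracePerp F 1 g :=
    mem_tracePerp.mpr ⟨by rw [one_mul]; exact hf.x_zero, hf.mul_x⟩
  have h2 : x₂ ∈ tracePerp F 1 g :=
    mem_tracePerp.mpr ⟨by rw [one_mul]; exact hf.y_zero, hf.mul_y⟩
  by_cases hs : s = 0
  · have hr : r ≠ 0 := by rintro rfl; simp [hs] at h
    refine ⟨(-w / r) • x₂, Submodule.smul_mem _ _ h2, ?_⟩
    rw [hs, zero_smul, add_zero, frobBracket_smul_left, frobBracket_smul_right,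
      frobBracket_swap x₂, smul_neg, smul_neg, smul_smul, ← neg_smul]
    congr 1
    field_simp
  · refine ⟨(w / s) • x₁, Submodule.smul_mem _ _ h1, ?_⟩
    rw [frobBracket_smul_left, frobBracket_add_right, frobBracket_smul_right,
      frobBracket_smul_right, frobBracket_self, smul_zero, zero_add, smul_smul]
    congr 1
    field_simp

omit [Finite K] in
include hf in
/-- Above a nonzero `x`, a point plane consists of the vectors `(x, c [u', x])` with `u'`
admissible. -/
theorem IsTraceFrame.exists_eq_of_mem_pointPlane {x t : K} (hx : x ≠ 0)
    (h : (x, t) ∈ pointPlane F c x₁ x₂ u) :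
    ∃ u', tr u' = 1 ∧ tr (g * u') = 0 ∧ t = c * frobBracket F u' x := by
  obtain ⟨r, s, w, rfl, rfl⟩ := mem_pointPlane.mp h
  obtain ⟨z, hz, hzw⟩ := hf.exists_frobBracket_eq_smul hx w
  rw [mem_tracePerp, one_mul] at hz
  refine ⟨u + z, ?_, ?_, ?_⟩
  · rw [map_add, hf.u_one, hz.1, add_zero]
  · rw [mul_add, map_add, hf.mul_u, hz.2, add_zero]
  · rw [frobBracket_add_left, hzw]

omit [Finite K] in
theorem exists_eq_smul_of_zero_mem_pointPlane {p : K}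
    (h : ((0 : K), p) ∈ pointPlane F c x₁ x₂ u) :
    ∃ w : F, p = w • (c * frobBracket F x₁ x₂) := by
  obtain ⟨r, s, w, h0, rfl⟩ := mem_pointPlane.mp h
  refine ⟨w, ?_⟩
  have : frobBracket F u 0 = 0 := by simp [frobBracket]
  rw [this, zero_add, mul_smul_comm]

omit [Finite K] in
include hf in
/-- The point of a point plane, seen from a nonzero `x` over which the plane lies. -/
theorem IsTraceFrame.exists_eq_of_zero_mem_pointPlane {p x t : K} (hx : x ≠ 0)
    (h : ((0 : K), p) ∈ pointPlane F c x₁ x₂ u) (hxt : (x, t) ∈ pointPlane F c x₁ x₂ u) :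
    ∃ y ∈ tracePerp F 1 g, p = c * frobBracket F y x := by
  obtain ⟨w, rfl⟩ := exists_eq_smul_of_zero_mem_pointPlane h
  obtain ⟨r, s, -, rfl, -⟩ := mem_pointPlane.mp hxt
  obtain ⟨z, hz, hzw⟩ := hf.exists_frobBracket_eq_smul hx w
  exact ⟨z, hz, by rw [hzw, mul_smul_comm]⟩

include hf in
/-- Two vectors of a point plane which are graph-like lie on the graph of one map
`x ↦ c [u', x]`. -/
theorem IsTraceFrame.exists_eq_of_pair_mem_pointPlane (hd : Module.finrank F K = 4)
    (hg : LinearIndependent F ![1, g]) {x x' t t' : K} (hxx : LinearIndependent F ![x, x'])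
    (h : (x, t) ∈ pointPlane F c x₁ x₂ u) (h' : (x', t') ∈ pointPlane F c x₁ x₂ u) :
    ∃ u', tr u' = 1 ∧ tr (g * u') = 0 ∧ t = c * frobBracket F u' x ∧
      t' = c * frobBracket F u' x' := by
  have hP : Module.finrank F (tracePerp F 1 g) = 2 := by have := finrank_tracePerp hg; omega
  have hx := hf.mem_tracePerp_of_mem_pointPlane h
  have hx' := hf.mem_tracePerp_of_mem_pointPlane h'
  obtain ⟨v, hv1, hv2, rfl⟩ := hf.exists_eq_of_mem_pointPlane (by simpa using hxx.ne_zero 0) h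
  obtain ⟨v', hv1', hv2', rfl⟩ := hf.exists_eq_of_mem_pointPlane (by simpa using hxx.ne_zero 1) h'
  obtain ⟨a, b, hab⟩ := exists_smul_add_smul_eq hP hx hx' hxx (x := v - v')
    (mem_tracePerp.mpr ⟨by rw [one_mul, map_sub, hv1, hv1', sub_self],
      by rw [mul_sub, map_sub, hv2, hv2', sub_self]⟩)
  rw [mem_tracePerp, one_mul] at hx
  have hu : v + (-a) • x = v' + b • x' := by
    rw [neg_smul, ← sub_eq_add_neg, sub_eq_iff_eq_add, add_assoc, add_comm (b • x'), hab]
    abel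
  refine ⟨v + (-a) • x, ?_, ?_, ?_, ?_⟩
  · rw [map_add, map_smul, hx.1, smul_zero, add_zero, hv1]
  · rw [mul_add, mul_smul_comm, map_add, map_smul, hx.2, smul_zero, add_zero, hv2]
  · rw [frobBracket_add_left, frobBracket_smul_left, frobBracket_self, smul_zero, add_zero]
  · rw [hu, frobBracket_add_left, frobBracket_smul_left, frobBracket_self, smul_zero, add_zero]

include hf in
/-- A plane with at least a line in common with a point plane meets it in a graph-like pair or
through its point. -/
theorem IsTraceFrame.exists_of_two_le_finrank_inf (hd : Module.finrank F K = 4)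
    (hg : LinearIndependent F ![1, g]) {D : Submodule F (K × K)}
    (h : 2 ≤ Module.finrank F ↥(pointPlane F c x₁ x₂ u ⊓ D)) :
    (∃ x x' u', LinearIndependent F ![x, x'] ∧ x ∈ tracePerp F 1 g ∧ x' ∈ tracePerp F 1 g ∧
      tr u' = 1 ∧ tr (g * u') = 0 ∧ (x, c * frobBracket F u' x) ∈ D ∧
      (x', c * frobBracket F u' x') ∈ D) ∨
    ∃ x y u', x ≠ 0 ∧ frobBracket F y x ≠ 0 ∧ IsTraceFrame F g x y u' ∧
      ((0 : K), c * frobBracket F y x) ∈ D ∧ (x, c * frobBracket F u' x) ∈ D := by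
  rcases exists_pair_of_two_le_finrank h with
    ⟨x, x', t, t', hx, hx', hxx⟩ | ⟨p, hp, hpD, x, t, hx, hxD⟩ | ⟨p, p', hpD, hpD', hpp⟩
  · obtain ⟨u', h1, h2, rfl, rfl⟩ :=
      hf.exists_eq_of_pair_mem_pointPlane hd hg hxx hx.1 hx'.1
    exact Or.inl ⟨x, x', u', hxx, hf.mem_tracePerp_of_mem_pointPlane hx.1,
      hf.mem_tracePerp_of_mem_pointPlane hx'.1, h1, h2, hx.2, hx'.2⟩
  · obtain ⟨u', h1, h2, rfl⟩ := hf.exists_eq_of_mem_pointPlane hx hxD.1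
    obtain ⟨y, hy, rfl⟩ := hf.exists_eq_of_zero_mem_pointPlane hx hpD.1 hxD.1
    have hxP := hf.mem_tracePerp_of_mem_pointPlane hxD.1
    rw [mem_tracePerp, one_mul] at hxP hy
    exact Or.inr ⟨x, y, u', hx, right_ne_zero_of_mul hp,
      ⟨hxP.1, hy.1, h1, hxP.2, hy.2, h2⟩, hpD.2, hxD.2⟩
  · obtain ⟨w, rfl⟩ := exists_eq_smul_of_zero_mem_pointPlane hpD.1
    obtain ⟨w', rfl⟩ := exists_eq_smul_of_zero_mem_pointPlane hpD'.1
    exfalso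
    have hw' : w' ≠ 0 := by
      rintro rfl
      exact hpp.ne_zero 1 (by simp)
    have := LinearIndependent.pair_iff.mp hpp w' (-w) (by rw [smul_smul, smul_smul]; module)
    exact hw' this.1

end PointPlane

theorem finrank_submodule_prod {F E M : Type*} [Field F] [AddCommGroup E] [Module F E]
    [AddCommGroup M] [Module F M] [FiniteDimensional F E] [FiniteDimensional F M]
    (p : Submodule F E) (q : Submodule F M) :
    Module.finrank F (p.prod q) = Module.finrank F p + Module.finrank F q := by
  have h1 : LinearMap.range (p.subtype.prodMap q.subtype) = p.prod q := by
    rw [LinearMap.range_prodMap, Submodule.range_subtype, Submodule.range_subtype]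
  rw [← h1, LinearMap.finrank_range_of_inj (p.subtype_injective.prodMap q.subtype_injective),
    Module.finrank_prod]

section Intersections

variable {F : Type*} [Field F] [Finite F] {K : Type*} [Field K] [Finite K] [Algebra F K]

local notation "σ" => frob F (K := K)
local notation "tr" => Algebra.trace F K

variable {c c' g g' x₁ x₂ u x₁' x₂' u' : K}

/-- Point planes with distinct parameters meet at most in a point. -/
theorem IsTraceFrame.eq_of_two_le_finrank_inf (hd : Module.finrank F K = 4)
    (hc : c ≠ 0) (hc' : c' ≠ 0) (hg : LinearIndependent F ![1, g])
    (hg' : LinearIndependent F ![1, g'])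
    (hf : IsTraceFrame F g x₁ x₂ u) (hf' : IsTraceFrame F g' x₁' x₂' u')
    (hbad : (∃ a : F, algebraMap F K a = g * σ (σ g)) →
      (∃ a : F, algebraMap F K a = g' * σ (σ g')) → ∃ a : F, a • g = g')
    (h : 2 ≤ Module.finrank F ↥(pointPlane F c x₁ x₂ u ⊓ pointPlane F c' x₁' x₂' u')) :
    c = c' ∧ ∃ a : F, a • g = g' := by
  rcases hf.exists_of_two_le_finrank_inf hd hg h with
    ⟨x, x', v, hxx, hx, hx', hv1, hv2, hD, hD'⟩ | ⟨x, y, v, hx, hyx, hfv, hD, hD'⟩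
  · obtain ⟨v', hv1', hv2', hev, hev'⟩ := hf'.exists_eq_of_pair_mem_pointPlane hd hg' hxx hD hD'
    obtain ⟨e1, e2⟩ := eq_zero_of_mul_add_mul_frob F (a := c' * σ v' - c * σ v)
      (b := c * v - c' * v') hxx (by rw [frobBracket, frobBracket] at hev; linear_combination hev)
      (by rw [frobBracket, frobBracket] at hev'; linear_combination hev')
    have hv0 : v ≠ 0 := by rintro rfl; simp at hv1
    have hσv0 : σ v ≠ 0 := (map_ne_zero _).mpr hv0
    -- `c v = c' v'` and `c v ^ q = c' v' ^ q` force `v' / v` into the ground field.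
    have hfix : σ (v' / v) = v' / v := by
      rw [map_div₀, div_eq_div_iff hσv0 hv0]
      refine mul_left_cancel₀ hc' ?_
      linear_combination v * e1 + σ v * e2
    obtain ⟨a, ha⟩ := exists_algebraMap_eq_of_frob_eq F hfix
    have hav : a • v = v' := by rw [Algebra.smul_def, ha, div_mul_cancel₀ _ hv0]
    have ha1 : a = 1 := by
      have := congrArg tr hav
      rwa [map_smul, hv1, hv1', smul_eq_mul, mul_one] at this
    rw [ha1, one_smul] at hav
    subst hav
    refine ⟨mul_right_cancel₀ hv0 (sub_eq_zero.mp e2), ?_⟩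
    have hP : Module.finrank F (tracePerp F x x') = 2 := by have := finrank_tracePerp hxx; omega
    have hx2 := hf'.mem_tracePerp_of_mem_pointPlane hD
    have hx2' := hf'.mem_tracePerp_of_mem_pointPlane hD'
    rw [mem_tracePerp, one_mul] at hx hx' hx2 hx2'
    obtain ⟨r, s, hrs⟩ := exists_smul_add_smul_eq hP (v := 1) (w := g) (x := g')
      (mem_tracePerp.mpr ⟨by rw [mul_one]; exact hx.1, by rw [mul_one]; exact hx'.1⟩)
      (mem_tracePerp.mpr ⟨by rw [mul_comm]; exact hx.2, by rw [mul_comm]; exact hx'.2⟩) hg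
      (mem_tracePerp.mpr ⟨by rw [mul_comm]; exact hx2.2, by rw [mul_comm]; exact hx2'.2⟩)
    have hr : r = 0 := by
      have := congrArg (fun w => tr (w * v)) hrs
      simpa [add_mul, hv1, hv2, hv2'] using this
    exact ⟨s, by rw [← hrs, hr, zero_smul, zero_add]⟩
  · obtain ⟨v', hv1', hv2', hev⟩ := hf'.exists_eq_of_mem_pointPlane hx hD'
    obtain ⟨y', hy', hey⟩ := hf'.exists_eq_of_zero_mem_pointPlane hx hD hD'
    have hx' := hf'.mem_tracePerp_of_mem_pointPlane hD'
    rw [mem_tracePerp, one_mul] at hx' hy'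
    have hfv' : IsTraceFrame F g' x y' v' := ⟨hx'.1, hy'.1, hv1', hx'.2, hy'.2, hv2'⟩
    exact hfv.eq_of_collision hd hx (by simpa using hg.ne_zero 1) (by simpa using hg'.ne_zero 1)
      hc hfv' hyx hey hev hbad hg

/-- The lifted codeword `{(x, a x + b x ^ q) : Tr x = 0}`. -/
noncomputable def traceGraph (F : Type*) [Field F] [Finite F] {K : Type*} [Field K] [Algebra F K]
    (a b : K) : Submodule F (K × K) :=
  graphOn (LinearMap.ker (Algebra.trace F K))
    (frobBinomial F a b ∘ₗ (LinearMap.ker (Algebra.trace F K)).subtype)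

omit [Finite K] in
theorem mem_traceGraph {a b x t : K} :
    (x, t) ∈ traceGraph F a b ↔ tr x = 0 ∧ t = a * x + b * σ x := by
  simp only [traceGraph, mem_graphOn, LinearMap.comp_apply, Submodule.subtype_apply,
    frobBinomial_apply, LinearMap.mem_ker, exists_prop, eq_comm]

omit [Finite K] in
theorem traceGraph_eq_of_two_le_finrank_inf {a b a' b' : K}
    (h : 2 ≤ Module.finrank F ↥(traceGraph F a b ⊓ traceGraph F a' b')) : a = a' ∧ b = b' := by
  obtain ⟨x, x', hind, hx, hx'⟩ := exists_pair_of_two_le_finrank_graphOn_inf h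
  exact eq_of_frobBinomial_eq hind
    ((mem_traceGraph.mp hx).2.trans (frobBinomial_apply ..).symm)
    ((mem_traceGraph.mp hx').2.trans (frobBinomial_apply ..).symm)

/-- A point plane has a line in common only with those lifted codewords which belong to the
removed set. -/
theorem IsTraceFrame.exists_eq_of_two_le_finrank_inf_traceGraph (hd : Module.finrank F K = 4)
    (hc : c ≠ 0) (hg : LinearIndependent F ![1, g])
    (hf : IsTraceFrame F g x₁ x₂ u) {a b : K}
    (h : 2 ≤ Module.finrank F ↥(pointPlane F c x₁ x₂ u ⊓ traceGraph F a b)) :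
    ∃ v : K, tr v = 1 ∧ a = -(c * σ v) ∧ b = c * v := by
  rcases hf.exists_of_two_le_finrank_inf hd hg h with
    ⟨x, x', v, hxx, -, -, hv1, -, hD, hD'⟩ | ⟨x, y, v, -, hyx, -, hD, -⟩
  · refine ⟨v, hv1, ?_⟩
    have e1 := (mem_traceGraph.mp hD).2
    have e2 := (mem_traceGraph.mp hD').2
    rw [frobBracket] at e1 e2
    obtain ⟨h1, h2⟩ := eq_zero_of_mul_add_mul_frob F (a := a + c * σ v) (b := b - c * v) hxx
      (by linear_combination -e1) (by linear_combination -e2)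
    exact ⟨eq_neg_of_add_eq_zero_left h1, sub_eq_zero.mp h2⟩
  · have e := (mem_traceGraph.mp hD).2
    rw [map_zero, mul_zero, mul_zero, add_zero] at e
    exact absurd e (mul_ne_zero hc hyx)

/-! ### Planes meeting the special subspace in a line -/

/-- The `F`-linear endomorphism `x ↦ x ^ (q ^ 2) + a x`. -/
noncomputable def frobFrobAdd (F : Type*) [Field F] [Finite F] {K : Type*} [Field K] [Algebra F K]
    (a : F) : K →ₗ[F] K :=
  (frob F).toLinearMap ∘ₗ (frob F).toLinearMap + a • LinearMap.id

omit [Finite K] in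
theorem frobFrobAdd_apply (a : F) (x : K) : frobFrobAdd F a x = σ (σ x) + a • x := by
  simp [frobFrobAdd]

omit [Finite K] in
theorem card_ker_frobFrobAdd_le (a : F) :
    Nat.card (LinearMap.ker (frobFrobAdd F a : K →ₗ[F] K)) ≤ Nat.card F ^ 2 := by
  classical
  have hq : 1 < Nat.card F ^ 2 := Nat.one_lt_pow two_ne_zero Finite.one_lt_card
  set p : Polynomial K := Polynomial.X ^ (Nat.card F ^ 2) +
    Polynomial.C (algebraMap F K a) * Polynomial.X with hp
  have hdeg : p.natDegree = Nat.card F ^ 2 := by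
    rw [hp, Polynomial.natDegree_add_eq_left_of_natDegree_lt] <;> rw [Polynomial.natDegree_X_pow]
    exact ((Polynomial.natDegree_C_mul_le _ _).trans Polynomial.natDegree_X_le).trans_lt hq
  have hp0 : p ≠ 0 := by rintro h; rw [h, Polynomial.natDegree_zero] at hdeg; omega
  have hsub : ((LinearMap.ker (frobFrobAdd F a : K →ₗ[F] K) : Submodule F K) : Set K) ⊆
      p.roots.toFinset := by
    intro x hx
    have hx : frobFrobAdd F a x = 0 := hx
    rw [frobFrobAdd_apply, frob_apply, frob_apply, ← pow_mul, ← sq, Algebra.smul_def] at hx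
    rw [Finset.mem_coe, Multiset.mem_toFinset, Polynomial.mem_roots hp0]
    simp [hp, hx]
  have h1 := Set.ncard_le_ncard hsub (Finset.finite_toSet _)
  rw [Set.ncard_coe_finset] at h1
  calc _ ≤ _ := h1
    _ ≤ _ := Multiset.toFinset_card_le _
    _ ≤ _ := Polynomial.card_roots' _
    _ = _ := hdeg

theorem finrank_ker_frobFrobAdd_le (a : F) :
    Module.finrank F (LinearMap.ker (frobFrobAdd F a : K →ₗ[F] K)) ≤ 2 := by
  have h := card_ker_frobFrobAdd_le (K := K) a
  rw [Module.natCard_eq_pow_finrank (K := F)] at h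
  exact (Nat.pow_le_pow_iff_right Finite.one_lt_card).mp h

/-- The quadratic subextension is two-dimensional. -/
theorem finrank_ker_frobFrobAdd_neg_one (hd : Module.finrank F K = 4) :
    Module.finrank F (LinearMap.ker (frobFrobAdd F (-1) : K →ₗ[F] K)) = 2 := by
  have hle : LinearMap.range (frobFrobAdd F (-1) : K →ₗ[F] K) ≤
      LinearMap.ker (frobFrobAdd F 1 : K →ₗ[F] K) := by
    rintro _ ⟨x, rfl⟩
    rw [LinearMap.mem_ker, frobFrobAdd_apply, frobFrobAdd_apply]
    simp only [map_add, map_smul, frob_quartic hd]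
    module
  have h1 := (frobFrobAdd F (-1) : K →ₗ[F] K).finrank_range_add_finrank_ker
  have h2 := Submodule.finrank_mono hle
  have h3 := finrank_ker_frobFrobAdd_le (K := K) (1 : F)
  have h4 := finrank_ker_frobFrobAdd_le (K := K) (-1 : F)
  omega

/-- There is an element with `x ^ q = -x`; it spans the distinguished point above which the
planes through lines of the special subspace are placed. -/
theorem exists_frob_eq_neg (hd : Module.finrank F K = 4) :
    ∃ x : K, x ≠ 0 ∧ σ x = -x ∧ tr x = 0 := by
  obtain ⟨y, hy, hy1⟩ : ∃ y ∈ LinearMap.ker (frobFrobAdd F (-1) : K →ₗ[F] K), σ y ≠ y := by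
    by_contra! h
    have hle : LinearMap.ker (frobFrobAdd F (-1) : K →ₗ[F] K) ≤ Submodule.span F {1} := by
      intro y hy
      obtain ⟨a, ha⟩ := exists_algebraMap_eq_of_frob_eq F (h y hy)
      exact Submodule.mem_span_singleton.mpr ⟨a, by rw [← ha, Algebra.smul_def, mul_one]⟩
    have h1 := Submodule.finrank_mono hle
    rw [finrank_ker_frobFrobAdd_neg_one hd, finrank_span_singleton one_ne_zero] at h1
    omega
  rw [LinearMap.mem_ker, frobFrobAdd_apply, neg_smul, one_smul, ← sub_eq_add_neg,
    sub_eq_zero] at hy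
  exact ⟨σ y - y, sub_ne_zero.mpr hy1, by rw [map_sub, hy]; ring,
    by rw [map_sub, trace_frob, sub_self]⟩

/-- The plane spanned by `(x, 0)` and the line `0 × y L`, where `L` is the quadratic
subextension. -/
noncomputable def linePlane (F : Type*) [Field F] [Finite F] {K : Type*} [Field K] [Algebra F K]
    (x y : K) : Submodule F (K × K) :=
  (Submodule.span F {x}).prod ((LinearMap.ker (frobFrobAdd F (-1))).map (LinearMap.mulLeft F y))

omit [Finite K] in
theorem mem_linePlane {x y z t : K} : (z, t) ∈ linePlane F x y ↔
    (∃ a : F, a • x = z) ∧ ∃ r : K, σ (σ r) = r ∧ y * r = t := by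
  simp only [linePlane, Submodule.mem_prod, Submodule.mem_span_singleton, Submodule.mem_map,
    LinearMap.mem_ker, frobFrobAdd_apply, neg_smul, one_smul, ← sub_eq_add_neg, sub_eq_zero,
    LinearMap.mulLeft_apply]

theorem finrank_linePlane (hd : Module.finrank F K = 4) {x y : K} (hx : x ≠ 0) (hy : y ≠ 0) :
    Module.finrank F (linePlane F x y) = 3 := by
  rw [linePlane, finrank_submodule_prod, finrank_span_singleton hx,
    ← (Submodule.equivMapOfInjective (LinearMap.mulLeft F y)
      (mul_right_injective₀ hy) _).finrank_eq, finrank_ker_frobFrobAdd_neg_one hd]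

/-- Point planes and line planes above the distinguished point meet at most in a point. -/
theorem IsTraceFrame.not_two_le_finrank_inf_linePlane (hd : Module.finrank F K = 4)
    (hc : c ≠ 0) (hg : LinearIndependent F ![1, g])
    (hf : IsTraceFrame F g x₁ x₂ u) {x y : K}
    (hx : x ≠ 0) (hσx : σ x = -x) :
    ¬ 2 ≤ Module.finrank F ↥(pointPlane F c x₁ x₂ u ⊓ linePlane F x y) := by
  intro h
  rcases hf.exists_of_two_le_finrank_inf hd hg h with
    ⟨z, z', v, hzz, -, -, -, -, hD, hD'⟩ | ⟨z, w, v, hz, hwz, hfv, hD, hD'⟩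
  · obtain ⟨⟨a, rfl⟩, -⟩ := mem_linePlane.mp hD
    obtain ⟨⟨b, rfl⟩, -⟩ := mem_linePlane.mp hD'
    have hb : b ≠ 0 := by rintro rfl; exact hzz.ne_zero 1 (by simp)
    exact hb (LinearIndependent.pair_iff.mp hzz b (-a)
      (by rw [smul_smul, smul_smul]; module)).1
  · obtain ⟨-, r, hr, hr'⟩ := mem_linePlane.mp hD
    obtain ⟨⟨a, rfl⟩, s, hs, hs'⟩ := mem_linePlane.mp hD'
    have ha : algebraMap F K a ≠ 0 := by
      intro h0
      rw [map_eq_zero] at h0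
      exact hz (by rw [h0, zero_smul])
    have hbr : ∀ w, frobBracket F w (a • x) = -(algebraMap F K a * x * (w + σ w)) := by
      intro w
      rw [frobBracket, map_smul, hσx, Algebra.smul_def, Algebra.smul_def]
      ring
    rw [hbr] at hr' hs' hwz
    have hr0 : r ≠ 0 := by
      rintro rfl
      rw [mul_zero] at hr'
      exact mul_ne_zero hc hwz hr'.symm
    have hy0 : y ≠ 0 := by
      rintro rfl
      rw [zero_mul] at hr'
      exact mul_ne_zero hc hwz hr'.symm
    -- `v + v ^ q` is a multiple of `w + w ^ q` by an element of the quadratic subextension, and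
    -- the trace of `w` is zero, so the trace of `v` would have to be zero.
    have hrel : r * (v + σ v) = s * (w + σ w) := by
      refine mul_left_cancel₀ (mul_ne_zero hc (mul_ne_zero ha hx)) ?_
      linear_combination r * hs' - s * hr'
    have hrel2 := congrArg σ (congrArg σ hrel)
    simp only [map_mul, map_add, hr, hs] at hrel2
    have htv := algebraMap_trace_quartic hd v
    have htw := algebraMap_trace_quartic hd w
    rw [hfv.u_one, map_one] at htv
    rw [hfv.y_zero, map_zero] at htw
    refine hr0 ?_
    linear_combination r * htv - s * htw + hrel + hrel2

omit [Finite K] in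
theorem exists_mul_eq_of_two_le_finrank_linePlane_inf {x y y' : K}
    (h : 2 ≤ Module.finrank F ↥(linePlane F x y ⊓ linePlane F x y')) :
    ∃ r : K, σ (σ r) = r ∧ y * r = y' := by
  have key : ∀ {z p : K}, p ≠ 0 → (z, p) ∈ linePlane F x y ⊓ linePlane F x y' →
      ∃ r : K, σ (σ r) = r ∧ y * r = y' := by
    rintro z p hp ⟨h1, h2⟩
    obtain ⟨-, r, hr, rfl⟩ := mem_linePlane.mp h1
    obtain ⟨-, s, hs, hs'⟩ := mem_linePlane.mp h2
    have hs0 : s ≠ 0 := by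
      rintro rfl
      rw [mul_zero] at hs'
      exact hp hs'.symm
    exact ⟨r / s, by rw [map_div₀, map_div₀, hr, hs], by rw [← mul_div_assoc, ← hs']; field_simp⟩
  rcases exists_pair_of_two_le_finrank h with
    ⟨z, z', t, t', hz, hz', hzz⟩ | ⟨p, hp, hpD, -⟩ | ⟨p, p', hpD, -, hpp⟩
  · exfalso
    obtain ⟨⟨a, rfl⟩, -⟩ := mem_linePlane.mp hz.1
    obtain ⟨⟨b, rfl⟩, -⟩ := mem_linePlane.mp hz'.1
    have hb : b ≠ 0 := by rintro rfl; exact hzz.ne_zero 1 (by simp)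
    exact hb (LinearIndependent.pair_iff.mp hzz b (-a)
      (by rw [smul_smul, smul_smul]; module)).1
  · exact key hp hpD
  · exact key (by simpa using hpp.ne_zero 0) hpD

omit [Finite K] in
theorem not_two_le_finrank_traceGraph_inf_linePlane {a b x y : K} :
    ¬ 2 ≤ Module.finrank F ↥(traceGraph F a b ⊓ linePlane F x y) := by
  intro h
  obtain ⟨z, z', hzz, hz, hz'⟩ := exists_pair_of_two_le_finrank_graphOn_inf h
  obtain ⟨⟨a, ha⟩, -⟩ := mem_linePlane.mp hz
  obtain ⟨⟨b, hb⟩, -⟩ := mem_linePlane.mp hz'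
  rw [← ha, ← hb] at hzz
  have hb : b ≠ 0 := by rintro rfl; exact hzz.ne_zero 1 (by simp)
  exact hb (LinearIndependent.pair_iff.mp hzz b (-a)
    (by rw [smul_smul, smul_smul]; module)).1

end Intersections

/-! ### Counting parameters -/

section Counting

/-- A transversal of the fibres of a map, all of which have at most `n` elements. -/
theorem exists_subset_injOn_card_le {α β : Type*} [DecidableEq β] (s : Finset α) (f : α → β)
    (n : ℕ) (hn : ∀ b, (s.filter fun a => f a = b).card ≤ n) :
    ∃ t ⊆ s, Set.InjOn f t ∧ s.card ≤ n * t.card := by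
  classical
  obtain ⟨t, hts, hinj, himg⟩ := Finset.exists_subset_injOn_image_eq_of_surjOn (f := f) (s : Set α)
    (s.image f) (by rw [Finset.coe_image]; exact Set.surjOn_image f s)
  refine ⟨t, Finset.coe_subset.mp hts, hinj, ?_⟩
  rw [← Finset.card_image_of_injOn hinj, himg]
  exact Finset.card_le_mul_card_image s n fun b _ => hn b

variable {F : Type*} [Field F] [Finite F] {K : Type*} [Field K] [Finite K] [Algebra F K]

local notation "σ" => frob F (K := K)
local notation "tr" => Algebra.trace F K

theorem natCard_trace_eq_one_le (hd : Module.finrank F K = 4) :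
    Nat.card {v : K // tr v = 1} ≤ Nat.card F ^ 3 := by
  have hker : Nat.card (LinearMap.ker (tr)) = Nat.card F ^ 3 := by
    have := finrank_ker_trace (F := F) (K := K)
    rw [Module.natCard_eq_pow_finrank (K := F)]
    congr 1
    omega
  rw [← hker]
  by_cases h : Nonempty {v : K // tr v = 1}
  · obtain ⟨v₀, hv₀⟩ := h
    refine Nat.card_le_card_of_injective
      (fun v => (⟨v.1 - v₀, by rw [LinearMap.mem_ker, map_sub, v.2, hv₀, sub_self]⟩ :
        LinearMap.ker (tr))) ?_
    intro v w hvw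
    exact Subtype.ext (sub_left_injective (congrArg Subtype.val hvw))
  · rw [not_nonempty_iff] at h
    simp

/-- The pairs `(a, b)` for which `x ↦ a x + b x ^ q` is not of the form `x ↦ c [v, x]` with
`Tr v = 1`. -/
def KeptPairs (F K : Type*) [Field F] [Finite F] [Field K] [Algebra F K] : Set (K × K) :=
  {p | ¬ ∃ c v : K, c ≠ 0 ∧ Algebra.trace F K v = 1 ∧ p = (-(c * frob F v), c * v)}

theorem le_natCard_keptPairs (hd : Module.finrank F K = 4) :
    Nat.card F ^ 8 ≤
      Nat.card (KeptPairs F K) + (Nat.card F ^ 4 - 1) * Nat.card F ^ 3 := by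
  classical
  let := Fintype.ofFinite K
  have hK : Nat.card K = Nat.card F ^ 4 := by rw [Module.natCard_eq_pow_finrank (K := F), hd]
  have hsub : (KeptPairs F K)ᶜ ⊆ Set.range fun p : Kˣ × {v : K // tr v = 1} =>
      (-((p.1 : K) * σ p.2.1), (p.1 : K) * p.2.1) := by
    intro p hp
    obtain ⟨c, v, hc, hv, rfl⟩ := not_not.mp hp
    exact ⟨(Units.mk0 c hc, ⟨v, hv⟩), rfl⟩
  have h1 : Set.ncard (KeptPairs F K)ᶜ ≤ (Nat.card F ^ 4 - 1) * Nat.card F ^ 3 := by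
    calc _ ≤ _ := Set.ncard_le_ncard hsub (Set.toFinite _)
      _ ≤ Nat.card (Kˣ × {v : K // tr v = 1}) := by
        rw [← Set.image_univ, ← Set.ncard_univ]
        exact Set.ncard_image_le (Set.toFinite _)
      _ ≤ _ := by
        rw [Nat.card_prod, Nat.card_units, hK]
        exact Nat.mul_le_mul_left _ (natCard_trace_eq_one_le hd)
  have h2 := Set.ncard_add_ncard_compl (KeptPairs F K)
  rw [Nat.card_prod, hK] at h2
  rw [Nat.card_coe_set_eq]
  have h3 : Nat.card F ^ 8 = Nat.card F ^ 4 * Nat.card F ^ 4 := by ring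
  omega

omit [Finite F] [Finite K] in
theorem linearIndependent_one_of_forall_ne {g : K} (hg : ∀ a : F, algebraMap F K a ≠ g) :
    LinearIndependent F ![1, g] := by
  rw [LinearIndependent.pair_iff]
  intro s t h
  have ht : t = 0 := by
    by_contra ht
    refine hg (-(s / t)) ?_
    have ht' : algebraMap F K t ≠ 0 := (map_ne_zero _).mpr ht
    rw [Algebra.smul_def, Algebra.smul_def, mul_one] at h
    rw [map_neg, map_div₀, neg_eq_iff_eq_neg, div_eq_iff ht']
    linear_combination h
  subst ht
  refine ⟨?_, rfl⟩
  rw [zero_smul, add_zero, Algebra.smul_def, mul_one] at h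
  exact (map_eq_zero _).mp h

omit [Finite K] in
/-- The nonzero `g` with `g ^ (q ^ 2 + 1)` in the ground field are roots of unity of order dividing
`(q ^ 2 + 1) (q - 1)`. -/
theorem card_filter_mul_frob_frob_mem_le [Fintype K] [DecidableEq K]
    [DecidablePred fun g : K => g ≠ 0 ∧ ∃ a : F, algebraMap F K a = g * σ (σ g)] :
    (Finset.univ.filter fun g : K => g ≠ 0 ∧ ∃ a : F, algebraMap F K a = g * σ (σ g)).card ≤
      (Nat.card F ^ 2 + 1) * (Nat.card F - 1) := by
  let := Fintype.ofFinite F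
  have hq : 1 < Nat.card F := Finite.one_lt_card
  have hsub : (Finset.univ.filter fun g : K => g ≠ 0 ∧ ∃ a : F, algebraMap F K a = g * σ (σ g)) ⊆
      (Polynomial.nthRoots ((Nat.card F ^ 2 + 1) * (Nat.card F - 1)) (1 : K)).toFinset := by
    intro g hg
    obtain ⟨-, hg0, a, ha⟩ := Finset.mem_filter.mp hg
    rw [Multiset.mem_toFinset,
      Polynomial.mem_nthRoots (Nat.mul_pos (by positivity) (by omega)), pow_mul]
    have h1 : g ^ (Nat.card F ^ 2 + 1) = algebraMap F K a := by
      rw [ha, frob_apply, frob_apply, ← pow_mul, ← sq, pow_succ']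
    have ha0 : a ≠ 0 := by
      rintro rfl
      rw [map_zero] at h1
      exact pow_ne_zero _ hg0 h1
    rw [h1, ← map_pow, Nat.card_eq_fintype_card, FiniteField.pow_card_sub_one_eq_one a ha0, map_one]
  exact (Finset.card_le_card hsub).trans
    ((Multiset.toFinset_card_le _).trans (Polynomial.card_nthRoots _ _))

/-- Parameters `g` of point planes: one from each class modulo scalars, and of those with
`g * g ^ (q ^ 2)` in the ground field at most one. -/
structure IsPointParameters (F : Type*) [Field F] [Finite F] {K : Type*} [Field K] [Algebra F K]
    (S : Finset K) : Prop where
  linearIndependent : ∀ g ∈ S, LinearIndependent F ![1, g]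
  eq_of_smul : ∀ g ∈ S, ∀ g' ∈ S, (∃ a : F, a • g = g') → g = g'
  exists_smul : ∀ g ∈ S, ∀ g' ∈ S, (∃ a : F, algebraMap F K a = g * frob F (frob F g)) →
    (∃ a : F, algebraMap F K a = g' * frob F (frob F g')) → ∃ a : F, a • g = g'

/-- There are `q ^ 3 + q` classes of `g` with `g ^ (q ^ 2 + 1)` outside the ground field; one more
class is added. If only scalars have `g ^ (q ^ 2 + 1)` in the ground field, there is no further class
to add, but the first count is then larger. -/
theorem exists_isPointParameters (hd : Module.finrank F K = 4) :
    ∃ S : Finset K, IsPointParameters F S ∧ Nat.card F ^ 3 + Nat.card F + 1 ≤ S.card := by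
  classical
  let := Fintype.ofFinite K
  let := Fintype.ofFinite F
  have hq : 1 < Nat.card F := Finite.one_lt_card
  have hK : Fintype.card K = Nat.card F ^ 4 := by
    rw [← Nat.card_eq_fintype_card, Module.natCard_eq_pow_finrank (K := F), hd]
  set q := Nat.card F with hqdef
  obtain ⟨n, hn⟩ : ∃ n, q = n + 1 := ⟨q - 1, by omega⟩
  let bad : K → Prop := fun g => ∃ a : F, algebraMap F K a = g * σ (σ g)
  have hbadF : ∀ a : F, bad (algebraMap F K a) := fun a =>
    ⟨a * a, by rw [AlgHom.commutes, AlgHom.commutes, map_mul]⟩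
  let B : Finset K := Finset.univ.filter fun g => g ≠ 0 ∧ bad g
  let G : Finset K := Finset.univ.filter fun g => ¬ bad g
  have hGind : ∀ g ∈ G, LinearIndependent F ![1, g] := by
    intro g hg
    refine linearIndependent_one_of_forall_ne fun a ha => ?_
    exact (Finset.mem_filter.mp hg).2 (ha ▸ hbadF a)
  have hGB : G.card + B.card + 1 = q ^ 4 := by
    have hB0 : Finset.univ.filter bad = insert 0 B := by
      ext g
      simp only [B, Finset.mem_filter, Finset.mem_univ, true_and, Finset.mem_insert]
      refine ⟨fun h => or_iff_not_imp_left.mpr fun h0 => ⟨h0, h⟩, ?_⟩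
      rintro (rfl | h)
      · simpa using hbadF 0
      · exact h.2
    have h1 := Finset.card_filter_add_card_filter_not (s := (Finset.univ : Finset K)) bad
    rw [hB0, Finset.card_insert_of_notMem (by simp [B]), Finset.card_univ, hK] at h1
    change B.card + 1 + G.card = q ^ 4 at h1
    omega
  -- It suffices to find the required number of parameters before passing to classes.
  suffices h : ∃ S : Finset K, (∀ g ∈ S, LinearIndependent F ![1, g]) ∧
      (∀ g ∈ S, ∀ g' ∈ S, bad g → bad g' → ∃ a : F, a • g = g') ∧
      (q - 1) * (q ^ 3 + q + 1) ≤ S.card by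
    obtain ⟨S, hS1, hS2, hS3⟩ := h
    obtain ⟨T, hTS, hinj, hcard⟩ := exists_subset_injOn_card_le S
      (fun g => Submodule.span F {g}) (q - 1) (fun b => by
        by_cases hne : (S.filter fun g => Submodule.span F {g} = b).Nonempty
        · obtain ⟨g₀, hg₀⟩ := hne
          obtain ⟨hg₀S, rfl⟩ := Finset.mem_filter.mp hg₀
          have hsub : (S.filter fun g => Submodule.span F {g} = Submodule.span F {g₀}) ⊆
              Finset.univ.image fun a : Fˣ => (a : F) • g₀ := by
            intro g hg
            obtain ⟨hgS, hge⟩ := Finset.mem_filter.mp hg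
            have hmem : g ∈ Submodule.span F {g₀} := hge ▸ Submodule.mem_span_singleton_self g
            obtain ⟨a, rfl⟩ := Submodule.mem_span_singleton.mp hmem
            have ha : a ≠ 0 := by
              rintro rfl
              exact (hS1 _ hgS).ne_zero 1 (by simp)
            exact Finset.mem_image.mpr ⟨Units.mk0 a ha, Finset.mem_univ _, rfl⟩
          refine (Finset.card_le_card hsub).trans (Finset.card_image_le.trans ?_)
          rw [Finset.card_univ, Fintype.card_units, ← Nat.card_eq_fintype_card]
        · rw [Finset.not_nonempty_iff_eq_empty.mp hne]
          simp)
    refine ⟨T, ⟨fun g hg => hS1 g (hTS hg), ?_, fun g hg g' hg' => hS2 g (hTS hg) g' (hTS hg')⟩,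
      Nat.le_of_mul_le_mul_left (hS3.trans hcard) (by omega)⟩
    rintro g hg _ hg' ⟨a, rfl⟩
    have ha : a ≠ 0 := by
      rintro rfl
      exact (hS1 _ (hTS hg')).ne_zero 1 (by simp)
    exact hinj hg hg' (Submodule.span_singleton_smul_eq (IsUnit.mk0 a ha) g).symm
  have hB := card_filter_mul_frob_frob_mem_le (F := F) (K := K)
  by_cases hex : ∃ g₁ : K, bad g₁ ∧ LinearIndependent F ![1, g₁]
  · obtain ⟨g₁, hg₁, hind⟩ := hex
    have hg₁0 : g₁ ≠ 0 := by simpa using hind.ne_zero 1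
    let S₁ : Finset K := Finset.univ.image fun a : Fˣ => (a : F) • g₁
    have hS₁ : ∀ g ∈ S₁, ∃ a : F, a ≠ 0 ∧ a • g₁ = g := by
      intro g hg
      obtain ⟨a, -, rfl⟩ := Finset.mem_image.mp hg
      exact ⟨a, a.ne_zero, rfl⟩
    have hbadS₁ : ∀ g ∈ S₁, bad g := by
      intro g hg
      obtain ⟨a, -, rfl⟩ := hS₁ g hg
      obtain ⟨b, hb⟩ := hg₁
      refine ⟨a * a * b, ?_⟩
      rw [map_smul, map_smul, map_mul, map_mul, hb, Algebra.smul_def, Algebra.smul_def]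
      ring
    have hcardS₁ : S₁.card = q - 1 := by
      rw [Finset.card_image_of_injective, Finset.card_univ, Fintype.card_units,
        ← Nat.card_eq_fintype_card]
      intro a b hab
      exact Units.ext (smul_left_injective F hg₁0 hab)
    refine ⟨G ∪ S₁, ?_, ?_, ?_⟩
    · intro g hg
      rcases Finset.mem_union.mp hg with hg | hg
      · exact hGind g hg
      · obtain ⟨a, ha, rfl⟩ := hS₁ g hg
        rw [LinearIndependent.pair_iff] at hind ⊢
        intro s t hst
        obtain ⟨h1, h2⟩ := hind s (t * a) (by rw [← hst, smul_smul])
        exact ⟨h1, (mul_eq_zero.mp h2).resolve_right ha⟩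
    · intro g hg g' hg' hb hb'
      have hg := (Finset.mem_union.mp hg).resolve_left fun h => (Finset.mem_filter.mp h).2 hb
      have hg' := (Finset.mem_union.mp hg').resolve_left fun h => (Finset.mem_filter.mp h).2 hb'
      obtain ⟨a, ha, rfl⟩ := hS₁ g hg
      obtain ⟨b, -, rfl⟩ := hS₁ g' hg'
      exact ⟨b / a, by rw [smul_smul, div_mul_cancel₀ _ ha]⟩
    · have hdisj : Disjoint G S₁ := Finset.disjoint_left.mpr fun g hg hg' =>
        (Finset.mem_filter.mp hg).2 (hbadS₁ g hg')
      rw [Finset.card_union_of_disjoint hdisj, hcardS₁]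
      have h1 : B.card ≤ (q ^ 2 + 1) * (q - 1) := hB
      rw [hn, Nat.add_sub_cancel] at h1 ⊢
      rw [hn] at hGB
      nlinarith
  · push Not at hex
    refine ⟨G, hGind, fun g hg g' hg' hb => absurd hb (Finset.mem_filter.mp hg).2, ?_⟩
    have hBsub : B ⊆ Finset.univ.image fun a : Fˣ => algebraMap F K a := by
      intro g hg
      obtain ⟨-, hg0, hgb⟩ := Finset.mem_filter.mp hg
      have : ∃ a : F, algebraMap F K a = g := by
        by_contra! h
        exact hex g hgb (linearIndependent_one_of_forall_ne h)
      obtain ⟨a, rfl⟩ := this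
      have ha : a ≠ 0 := by rintro rfl; simp at hg0
      exact Finset.mem_image.mpr ⟨Units.mk0 a ha, Finset.mem_univ _, rfl⟩
    have h1 : B.card ≤ q - 1 := by
      refine (Finset.card_le_card hBsub).trans (Finset.card_image_le.trans ?_)
      rw [Finset.card_univ, Fintype.card_units, ← Nat.card_eq_fintype_card]
    rw [hn, Nat.add_sub_cancel] at h1 ⊢
    rw [hn] at hGB
    nlinarith [Nat.zero_le (n ^ 3), Nat.zero_le (n ^ 2), Nat.zero_le (n ^ 4)]

/-- Representatives of the lines `y L`, where `L` is the quadratic subextension. The lines form a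
spread with `q ^ 2 + 1` elements; `q + 1` of them suffice. -/
theorem exists_linePlane_parameters (hd : Module.finrank F K = 4) :
    ∃ S : Finset K, (∀ y ∈ S, y ≠ 0) ∧
      (∀ y ∈ S, ∀ y' ∈ S, (∃ r : K, σ (σ r) = r ∧ y * r = y') → y = y') ∧
      Nat.card F + 1 ≤ S.card := by
  classical
  let := Fintype.ofFinite K
  have hq : 1 < Nat.card F := Finite.one_lt_card
  have hK : Fintype.card K = Nat.card F ^ 4 := by
    rw [← Nat.card_eq_fintype_card, Module.natCard_eq_pow_finrank (K := F), hd]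
  let L : Submodule F K := LinearMap.ker (frobFrobAdd F (-1))
  have hL : ∀ r, r ∈ L ↔ σ (σ r) = r := fun r => by
    rw [LinearMap.mem_ker, frobFrobAdd_apply, neg_smul, one_smul, ← sub_eq_add_neg, sub_eq_zero]
  have hLcard : Nat.card L ≤ Nat.card F ^ 2 := card_ker_frobFrobAdd_le _
  obtain ⟨S, hS, hinj, hcard⟩ := exists_subset_injOn_card_le (Finset.univ.erase (0 : K))
    (fun y => L.map (LinearMap.mulLeft F y)) (Nat.card F ^ 2) (fun b => by
      by_cases hne : ((Finset.univ.erase (0 : K)).filter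
          fun y => L.map (LinearMap.mulLeft F y) = b).Nonempty
      · obtain ⟨y₀, hy₀⟩ := hne
        obtain ⟨-, rfl⟩ := Finset.mem_filter.mp hy₀
        have hsub : ((Finset.univ.erase (0 : K)).filter
            fun y => L.map (LinearMap.mulLeft F y) = L.map (LinearMap.mulLeft F y₀)) ⊆
            (Set.toFinite (L : Set K)).toFinset.image fun r => y₀ * r := by
          intro y hy
          obtain ⟨-, hye⟩ := Finset.mem_filter.mp hy
          have hmem : y ∈ L.map (LinearMap.mulLeft F y) := ⟨1, by
            rw [SetLike.mem_coe, hL, map_one, map_one], by simp⟩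
          rw [hye] at hmem
          obtain ⟨r, hr, rfl⟩ := hmem
          exact Finset.mem_image.mpr ⟨r, by simpa using hr, rfl⟩
        refine (Finset.card_le_card hsub).trans (Finset.card_image_le.trans ?_)
        rw [← Set.ncard_eq_toFinset_card]
        exact hLcard
      · rw [Finset.not_nonempty_iff_eq_empty.mp hne]
        simp)
  have hS0 : ∀ y ∈ S, y ≠ 0 := fun y hy => Finset.ne_of_mem_erase (hS hy)
  refine ⟨S, hS0, ?_, ?_⟩
  · rintro y hy _ hy' ⟨r, hr, rfl⟩
    have hr0 : r ≠ 0 := right_ne_zero_of_mul (hS0 _ hy')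
    refine hinj hy hy' (SetLike.ext fun t => ⟨?_, ?_⟩)
    · rintro ⟨s, hs, rfl⟩
      refine ⟨s / r, (hL _).mpr ?_, ?_⟩
      · rw [map_div₀, map_div₀, hr, (hL s).mp hs]
      · simp only [LinearMap.mulLeft_apply]; field_simp
    · rintro ⟨s, hs, rfl⟩
      refine ⟨r * s, (hL _).mpr ?_, ?_⟩
      · rw [map_mul, map_mul, hr, (hL s).mp hs]
      · simp only [LinearMap.mulLeft_apply]; ring
  · rw [Finset.card_erase_of_mem (Finset.mem_univ _), Finset.card_univ, hK] at hcard
    by_contra! hlt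
    have h1 : Nat.card F ^ 2 * S.card ≤ Nat.card F ^ 2 * Nat.card F :=
      Nat.mul_le_mul_left _ (by omega)
    have h2 : Nat.card F ^ 2 * Nat.card F + 1 < Nat.card F ^ 4 := by
      have h3 : Nat.card F ^ 4 = Nat.card F ^ 2 * Nat.card F * Nat.card F := by ring
      have h4 : 0 < Nat.card F ^ 2 * Nat.card F := by positivity
      nlinarith
    omega

end Counting

/-! ### The code in dimension seven -/

/-- The expurgated and augmented lifted code: graphs which are not removed, point planes and line
planes. -/
theorem le_maxCodeSize_seven (F : Type*) [Field F] [Finite F] :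
    Nat.card F ^ 8 + Nat.card F ^ 5 + Nat.card F ^ 4 ≤ maxCodeSize F 7 4 3 := by
  classical
  obtain ⟨K, _, _, _, hd⟩ := exists_field_finrank_eq F (j := 4) (by norm_num)
  obtain ⟨S, hS, hScard⟩ := exists_isPointParameters (F := F) hd
  obtain ⟨T, hT0, hT, hTcard⟩ := exists_linePlane_parameters (F := F) hd
  obtain ⟨x₀, hx₀, hσx₀, htx₀⟩ := exists_frob_eq_neg (F := F) hd
  have hframe : ∀ g : S, ∃ x₁ x₂ u : K, LinearIndependent F ![x₁, x₂] ∧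
      IsTraceFrame F g.1 x₁ x₂ u := fun g =>
    exists_isTraceFrame hd (hS.linearIndependent g.1 g.2)
  choose x₁ x₂ u hind hf using hframe
  have hmain := natCard_le_maxCodeSize (F := F) (E := K × K) (v := 7)
    (P := (LinearMap.ker (Algebra.trace F K)).prod ⊤)
    (by
      have := finrank_ker_trace (F := F) (K := K)
      rw [finrank_submodule_prod, finrank_top]
      omega)
    (ι := KeptPairs F K ⊕ (Kˣ × S) ⊕ T)
    (fun i => match i with
      | .inl p => traceGraph F p.1.1 p.1.2
      | .inr (.inl (c, g)) => pointPlane F (c : K) (x₁ g) (x₂ g) (u g)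
      | .inr (.inr y) => linePlane F x₀ y.1)
    ?_ ?_ ?_
  · have h1 := le_natCard_keptPairs (F := F) hd
    have hK : Nat.card K = Nat.card F ^ 4 := by rw [Module.natCard_eq_pow_finrank (K := F), hd]
    rw [Nat.card_sum, Nat.card_sum, Nat.card_prod, Nat.card_units, hK,
      Nat.card_eq_fintype_card (α := S), Fintype.card_coe,
      Nat.card_eq_fintype_card (α := T), Fintype.card_coe] at hmain
    refine le_trans ?_ hmain
    have h2 := Nat.mul_le_mul_left (Nat.card F ^ 4 - 1) hScard
    obtain ⟨m, hm⟩ : ∃ m, Nat.card F ^ 4 = m + 1 :=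
      ⟨Nat.card F ^ 4 - 1, by have : 0 < Nat.card F ^ 4 := pow_pos Nat.card_pos 4
                              omega⟩
    have h5 : Nat.card F ^ 5 = (m + 1) * Nat.card F := by rw [← hm]; ring
    rw [hm, Nat.add_sub_cancel] at h1 h2 ⊢
    rw [h5]
    nlinarith
  · rintro (p | ⟨c, g⟩ | y)
    · rintro ⟨x, t⟩ h
      exact ⟨(mem_traceGraph.mp h).1, trivial⟩
    · rintro ⟨x, t⟩ h
      have := mem_tracePerp.mp ((hf g).mem_tracePerp_of_mem_pointPlane h)
      rw [one_mul] at this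
      exact ⟨this.1, trivial⟩
    · rintro ⟨x, t⟩ h
      obtain ⟨⟨a, rfl⟩, -⟩ := mem_linePlane.mp h
      exact ⟨by rw [SetLike.mem_coe, LinearMap.mem_ker, map_smul, htx₀, smul_zero], trivial⟩
  · rintro (p | ⟨c, g⟩ | y)
    · have := finrank_ker_trace (F := F) (K := K)
      exact finrank_graphOn.trans (by omega)
    · exact finrank_pointPlane c.ne_zero (hind g)
    · exact finrank_linePlane hd hx₀ (hT0 _ y.2)
  · have hkept : ∀ (p : KeptPairs F K) (c : Kˣ) (g : S),
        ¬ 2 ≤ Module.finrank F ↥(pointPlane F (c : K) (x₁ g) (x₂ g) (u g) ⊓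
          traceGraph F p.1.1 p.1.2) := by
      intro p c g h
      obtain ⟨v, hv, ha, hb⟩ := (hf g).exists_eq_of_two_le_finrank_inf_traceGraph hd c.ne_zero
        (hS.linearIndependent _ g.2) h
      exact p.2 ⟨c, v, c.ne_zero, hv, Prod.ext ha hb⟩
    have hline : ∀ (c : Kˣ) (g : S) (y : T),
        ¬ 2 ≤ Module.finrank F ↥(pointPlane F (c : K) (x₁ g) (x₂ g) (u g) ⊓
          linePlane F x₀ y.1) := fun c g y =>
      (hf g).not_two_le_finrank_inf_linePlane hd c.ne_zero (hS.linearIndependent _ g.2) hx₀ hσx₀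
    rintro (p | ⟨c, g⟩ | y) (p' | ⟨c', g'⟩ | y') h
    · obtain ⟨h1, h2⟩ := traceGraph_eq_of_two_le_finrank_inf h
      rw [Subtype.ext (Prod.ext h1 h2)]
    · exact absurd (by rwa [inf_comm] at h) (hkept p c' g')
    · exact absurd h not_two_le_finrank_traceGraph_inf_linePlane
    · exact absurd h (hkept p' c g)
    · obtain ⟨h1, h2⟩ := (hf g).eq_of_two_le_finrank_inf hd c.ne_zero c'.ne_zero
        (hS.linearIndependent _ g.2) (hS.linearIndependent _ g'.2) (hf g')
        (hS.exists_smul _ g.2 _ g'.2) h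
      rw [Units.ext h1, Subtype.ext (hS.eq_of_smul _ g.2 _ g'.2 h2)]
    · exact absurd h (hline c g y')
    · exact absurd (by rwa [inf_comm] at h) not_two_le_finrank_traceGraph_inf_linePlane
    · exact absurd (by rwa [inf_comm] at h) (hline c' g' y)
    · rw [Subtype.ext (hT _ y.2 _ y'.2 (exists_mul_eq_of_two_le_finrank_linePlane_inf h))]

/-! ### Asymptotics -/

section Asymptotics

variable (F : Type*) [Field F] [Finite F]

/-- A codeword is determined by two of its independent vectors. -/
theorem maxCodeSize_le_pow (v : ℕ) : maxCodeSize F v 4 3 ≤ Nat.card F ^ (2 * v) := by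
  obtain ⟨C, hC, hcard⟩ := exists_isConstDimCode_card_eq F v 4 3
  have hpair : ∀ U : C, ∃ x y : Fin v → F, x ∈ U.1 ∧ y ∈ U.1 ∧ LinearIndependent F ![x, y] := by
    intro U
    obtain ⟨x, hx, y, hy, h⟩ := exists_linearIndependent_pair_of_two_le_finrank (D := U.1)
      (by rw [hC.1 U.1 U.2]; norm_num)
    exact ⟨x, y, hx, hy, h⟩
  choose x y hx hy hxy using hpair
  have hinj : Function.Injective fun U : C => (x U, y U) := by
    intro U W h
    obtain ⟨h1, h2⟩ := Prod.mk.inj h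
    by_contra hne
    have h3 := (four_le_subspaceDist_iff (hC.1 _ U.2) (hC.1 _ W.2)).mp
      (hC.2 _ U.2 _ W.2 fun h => hne (Subtype.ext h))
    have h4 : Submodule.span F {x U, y U} ≤ U.1 ⊓ W.1 := by
      rw [Submodule.span_le]
      rintro z (rfl | rfl)
      · exact ⟨hx U, h1 ▸ hx W⟩
      · exact ⟨hy U, h2 ▸ hy W⟩
    have h5 := Submodule.finrank_mono h4
    rw [finrank_span_pair_eq_two (hxy U)] at h5
    omega
  have h := Nat.card_le_card_of_injective _ hinj
  rw [Nat.card_eq_fintype_card, Fintype.card_coe, hcard, Nat.card_prod, Nat.card_fun,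
    Nat.card_fin] at h
  calc _ ≤ _ := h
    _ = _ := by ring

/-- The normalized code sizes converge to their supremum: linkage makes them monotone along all
steps of length at least three. -/
theorem exists_tendsto_maxCodeSize_div_pow :
    ∃ s : ℝ, Filter.Tendsto (fun v : ℕ => (maxCodeSize F v 4 3 : ℝ) / (Nat.card F : ℝ) ^ (2 * v))
      Filter.atTop (nhds s) ∧
      ∀ m, (maxCodeSize F m 4 3 : ℝ) / (Nat.card F : ℝ) ^ (2 * m) ≤ s := by
  have hq : (0 : ℝ) < Nat.card F := by exact_mod_cast Nat.card_pos
  set a : ℕ → ℝ := fun v => (maxCodeSize F v 4 3 : ℝ) / (Nat.card F : ℝ) ^ (2 * v) with ha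
  have hbdd : BddAbove (Set.range a) := by
    refine ⟨1, ?_⟩
    rintro _ ⟨v, rfl⟩
    rw [ha]
    simp only
    rw [div_le_one (by positivity)]
    exact_mod_cast maxCodeSize_le_pow F v
  have hmono : ∀ m v, m + 3 ≤ v → a m ≤ a v := by
    intro m v hv
    obtain ⟨j, rfl⟩ := Nat.exists_eq_add_of_le (show m ≤ v by omega)
    have h := maxCodeSize_mul_le F m (j := j) (by omega)
    have h' : (maxCodeSize F m 4 3 : ℝ) * (Nat.card F : ℝ) ^ (2 * j) ≤
        maxCodeSize F (m + j) 4 3 := by exact_mod_cast h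
    simp only [ha]
    rw [div_le_div_iff₀ (by positivity) (by positivity), mul_add, pow_add]
    calc _ = (maxCodeSize F m 4 3 : ℝ) * (Nat.card F : ℝ) ^ (2 * j) *
          (Nat.card F : ℝ) ^ (2 * m) := by ring
      _ ≤ _ := by gcongr
  refine ⟨⨆ v, a v, ?_, fun m => le_ciSup hbdd m⟩
  rw [Metric.tendsto_atTop]
  intro ε hε
  obtain ⟨m, hm⟩ := exists_lt_of_lt_ciSup (show (⨆ v, a v) - ε < ⨆ v, a v by linarith)
  refine ⟨m + 3, fun v hv => ?_⟩
  have h1 := hmono m v hv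
  have h2 := le_ciSup hbdd v
  rw [Real.dist_eq, abs_lt]
  constructor <;> linarith

/-- The limit of the bound for codes containing a lifted maximum rank distance code, relative to
`q ^ (2 v)`. -/
theorem tendsto_mrdBound_div_pow {q : ℕ} (hq : 2 ≤ q) :
    Filter.Tendsto
      (fun v : ℕ => ((q : ℝ) ^ (2 * v - 6) + gaussBinom q (v - 3) 2) / (q : ℝ) ^ (2 * v))
      Filter.atTop
      (nhds (((q : ℝ) ^ 6)⁻¹ * (1 + 1 / ((q : ℝ) * (q - 1) * ((q : ℝ) ^ 2 - 1))))) := by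
  have hq1 : (1 : ℝ) < q := by exact_mod_cast hq
  have hq0 : (q : ℝ) ≠ 0 := by positivity
  have h1 : (q : ℝ) - 1 ≠ 0 := by linarith
  have h2 : (q : ℝ) ^ 2 - 1 ≠ 0 := by nlinarith
  have hinv : Filter.Tendsto (fun n : ℕ => ((q : ℝ)⁻¹) ^ n) Filter.atTop (nhds 0) :=
    tendsto_pow_atTop_nhds_zero_of_lt_one (by positivity) (inv_lt_one_of_one_lt₀ hq1)
  have hlim : Filter.Tendsto (fun n : ℕ => ((q : ℝ) ^ 6)⁻¹ * (1 +
      ((q : ℝ)⁻¹ - ((q : ℝ)⁻¹) ^ n) * (1 - ((q : ℝ)⁻¹) ^ n) /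
        (((q : ℝ) - 1) * ((q : ℝ) ^ 2 - 1)))) Filter.atTop
      (nhds (((q : ℝ) ^ 6)⁻¹ * (1 + ((q : ℝ)⁻¹ - 0) * (1 - 0) /
        (((q : ℝ) - 1) * ((q : ℝ) ^ 2 - 1))))) :=
    ((((tendsto_const_nhds.sub hinv).mul (tendsto_const_nhds.sub hinv)).div_const _).const_add
      1).const_mul _
  rw [← Filter.tendsto_add_atTop_iff_nat 5]
  -- The shift by five makes all truncated subtractions in the bound genuine.
  convert (Filter.tendsto_add_atTop_iff_nat 2).mpr hlim using 2 with n
  · have e1 : 2 * (n + 5) - 6 = 2 * n + 4 := by omega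
    have e2 : n + 5 - 3 = n + 2 := by omega
    rw [e1, e2, gaussBinom, if_pos (by omega)]
    have e3 : Finset.Icc 1 2 = {1, 2} := rfl
    rw [e3, Finset.prod_pair (by norm_num), Nat.add_sub_cancel]
    rw [pow_one, inv_pow]
    field_simp
    ring
  · field_simp
    ring

end Asymptotics

theorem mainTheorem3 (F : Type*) [Field F] [Finite F] (q : ℕ) (hqF : Nat.card F = q)
    (hq : 3 ≤ q) :
    (∃ L : ℝ,
      Filter.Tendsto
        (fun v : ℕ => (maxCodeSize F v 4 3 : ℝ) /
          ((q : ℝ) ^ (2 * v - 6) + gaussBinom q (v - 3) 2))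
        Filter.atTop (nhds L) ∧
      1 + 1 / (2 * (q : ℝ) ^ 3) ≤ L) ∧
    (∃ v₀ : ℕ, ∀ v : ℕ, v₀ ≤ v →
      ∃ C : Finset (Submodule F (Fin v → F)), IsConstDimCode F v 4 3 C ∧
        (q : ℝ) ^ (2 * v - 6) + gaussBinom q (v - 3) 2 < (C.card : ℝ)) ∧
    (∀ v : ℕ, 12 ≤ v →
      q ^ (2 * v - 10) * (q ^ 4 + q + 1) ≤ maxCodeSize F v 4 3) := by
  subst hqF
  set q := Nat.card F with hqdef
  have hbase := le_maxCodeSize_seven F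
  rw [← hqdef] at hbase
  have hq3 : (3 : ℝ) ≤ q := by exact_mod_cast hq
  obtain ⟨s, hs, hsup⟩ := exists_tendsto_maxCodeSize_div_pow F
  rw [← hqdef] at hs hsup
  have hden := tendsto_mrdBound_div_pow (q := q) (by omega)
  set ε : ℝ := 1 / ((q : ℝ) * (q - 1) * ((q : ℝ) ^ 2 - 1)) with hε
  have hq2 : (0 : ℝ) < (q : ℝ) ^ 2 - 1 := by nlinarith
  have hq1 : (0 : ℝ) < (q : ℝ) - 1 := by linarith
  have hε0 : 0 < ε := by rw [hε]; positivity
  have hlim := hs.div hden (by positivity)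
  have hL : 1 + 1 / (2 * (q : ℝ) ^ 3) ≤ s / (((q : ℝ) ^ 6)⁻¹ * (1 + ε)) := by
    have h1 : (q : ℝ) ^ 8 + (q : ℝ) ^ 5 + (q : ℝ) ^ 4 ≤ maxCodeSize F 7 4 3 := by
      exact_mod_cast hbase
    have h2 := (div_le_div_of_nonneg_right h1 (by positivity)).trans (hsup 7)
    rw [le_div_iff₀ (by positivity)]
    refine le_trans ?_ h2
    -- After clearing denominators, the claim is `q` times this quartic being nonnegative, which
    -- needs `q ≥ 3`.
    have hq4 : 0 ≤ (q : ℝ) * ((q : ℝ) ^ 4 - q ^ 3 - 3 * q ^ 2 - q + 1) := by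
      refine mul_nonneg (by linarith) ?_
      nlinarith [mul_nonneg (sub_nonneg.mpr hq3) (by positivity : (0 : ℝ) ≤ (q : ℝ) ^ 3),
        mul_nonneg (sub_nonneg.mpr hq3) (by positivity : (0 : ℝ) ≤ (q : ℝ) ^ 2),
        mul_nonneg (sub_nonneg.mpr hq3) (by positivity : (0 : ℝ) ≤ (q : ℝ))]
    have hd : (0 : ℝ) < q * (q - 1) * ((q : ℝ) ^ 2 - 1) := by positivity
    have e1 : (1 + 1 / (2 * (q : ℝ) ^ 3)) * (((q : ℝ) ^ 6)⁻¹ * (1 + ε)) =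
        (2 * (q : ℝ) ^ 3 + 1) * (q * (q - 1) * ((q : ℝ) ^ 2 - 1) + 1) /
          (2 * (q : ℝ) ^ 9 * (q * (q - 1) * ((q : ℝ) ^ 2 - 1))) := by
      rw [hε]; field_simp
    rw [e1, div_le_div_iff₀ (by positivity) (by positivity)]
    have h3 := mul_nonneg hq4 (by positivity : (0 : ℝ) ≤ (q : ℝ) ^ 13)
    linear_combination h3
  have hlim' : Filter.Tendsto (fun v : ℕ => (maxCodeSize F v 4 3 : ℝ) /
      ((q : ℝ) ^ (2 * v - 6) + gaussBinom q (v - 3) 2)) Filter.atTop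
      (nhds (s / (((q : ℝ) ^ 6)⁻¹ * (1 + ε)))) := by
    refine hlim.congr fun v => ?_
    rw [Pi.div_apply, div_div_div_cancel_right₀ (by positivity)]
  refine ⟨⟨_, hlim', hL⟩, ?_, ?_⟩
  · have h1 : (1 : ℝ) < s / (((q : ℝ) ^ 6)⁻¹ * (1 + ε)) := by
      refine lt_of_lt_of_le ?_ hL
      have : (0 : ℝ) < 1 / (2 * (q : ℝ) ^ 3) := by positivity
      linarith
    have hpos := hden.eventually_const_lt (show (0 : ℝ) < ((q : ℝ) ^ 6)⁻¹ * (1 + ε) by positivity)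
    obtain ⟨v₀, hv₀⟩ := Filter.eventually_atTop.mp ((hlim'.eventually_const_lt h1).and hpos)
    refine ⟨v₀, fun v hv => ?_⟩
    obtain ⟨h2, h3⟩ := hv₀ v hv
    obtain ⟨C, hC, hcard⟩ := exists_isConstDimCode_card_eq F v 4 3
    refine ⟨C, hC, ?_⟩
    have h4 : 0 < (q : ℝ) ^ (2 * v - 6) + gaussBinom q (v - 3) 2 :=
      (div_pos_iff_of_pos_right (by positivity)).mp h3
    rw [hcard]
    exact (one_lt_div h4).mp h2
  · intro v hv
    obtain ⟨j, rfl⟩ := Nat.exists_eq_add_of_le (show 7 ≤ v by omega)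
    have h := maxCodeSize_mul_le F 7 (j := j) (by omega)
    have e : 2 * (7 + j) - 10 = 2 * j + 4 := by omega
    rw [e]
    calc _ = (q ^ 8 + q ^ 5 + q ^ 4) * q ^ (2 * j) := by ring
      _ ≤ _ := Nat.mul_le_mul_right _ hbase
      _ ≤ _ := h
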